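/- Let $(R,\mathfrak m)$ be a Noetherian local ring with residue field $\Bbbk$, let $I\subseteq R$ be an ideal, and let $M$ be a finitely generated $R$-module. Suppose that $g=\operatorname{grade}(I,M)=\min\{i\in\mathbb N : \operatorname{Ext}^i_R(R/I,M)\neq 0\}$ exists (that is, $IM\neq M$). Let $E=E_R(\Bbbk)$ be an injective hull of $\Bbbk$ and $D(\cdot)=\operatorname{Hom}_R(\cdot,E)$. Let $H^i_I$ denote the $i$-th right derived functor of the $I$-power torsion functor $\Gamma_I$, and let $\hat R,\hat M$ be the $\mathfrak m$-adic completions. Every element of $E$ is annihilated by a power of $\mathfrak m$, so $E$ is an $\hat R$-module, and $\hat R$ acts on $D(X)$ through $E$ for every $R$-module $X$. Put $H=H^g_I(M)$ and $\hat H=H^g_{I\hat R}(\hat M)$, and let $\iota:H\to\hat H$ be the natural map induced by $M\to\hat M$. (1) Every $f\in D(H)$ extends uniquely along $\iota$: there is exactly one $\hat R$-linear map $F:\hat H\to E$ with $F\circ\iota=f$. There is a natural isomorphism of $\hat R$-modules $$\Theta:\operatorname{Hom}_{\hat R}(\hat H,\hat H)\ \xrightarrow{\ \cong\ }\ \operatorname{Hom}_R(D(H),D(H)),$$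 namely the one given by transposition: $\Theta(\varphi)(F\circ\iota)=F\circ\varphi\circ\iota$ for all $\varphi\in\operatorname{Hom}_{\hat R}(\hat H,\hat H)$ and all $\hat R$-linear $F:\hat H\to E$. (2) The following conditions are equivalent: (i) the evaluation map $H\otimes_R D(H)\to E$, $x\otimes f\mapsto f(x)$, is an isomorphism; (ii) the natural map $\hat R\to\operatorname{Hom}_{\hat R}(\hat H,\hat H)$, sending $a$ to multiplication by $a$, is an isomorphism; (iii) the natural map $\hat R\to\operatorname{Hom}_R(D(H),D(H))$, sending $a$ to multiplication by $a$, is an isomorphism. -/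

import Mathlib

open CategoryTheory

universe u

namespace LocCoh

section Torsion

variable {R : Type u} [CommRing R]

/-- `Γ_I(X)`: the submodule of the elements of `X` that are killed by some power of `I`. -/
def powTorsion (I : Ideal R) (X : Type u) [AddCommGroup X] [Module R X] : Submodule R X where
  carrier := {x | ∃ n : ℕ, ∀ a ∈ I ^ n, a • x = 0}
  zero_mem' := ⟨0, fun _ _ => smul_zero _⟩
  add_mem' := by
    rintro x y ⟨m, hm⟩ ⟨n, hn⟩
    refine ⟨m + n, fun a ha => ?_⟩
    rw [smul_add, hm a (Ideal.pow_le_pow_right (Nat.le_add_right m n) ha),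
      hn a (Ideal.pow_le_pow_right (Nat.le_add_left n m) ha), add_zero]
  smul_mem' := by
    rintro c x ⟨n, hn⟩
    exact ⟨n, fun a ha => by rw [smul_comm, hn a ha, smul_zero]⟩

theorem map_mem_powTorsion (I : Ideal R) {X Y : Type u} [AddCommGroup X] [Module R X]
    [AddCommGroup Y] [Module R Y] (f : X →ₗ[R] Y) {x : X} (hx : x ∈ powTorsion I X) :
    f x ∈ powTorsion I Y := by
  obtain ⟨n, hn⟩ := hx
  exact ⟨n, fun a ha => by rw [← map_smul, hn a ha, map_zero]⟩

/-- The section functor `Γ_I` on `R`-modules. -/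
noncomputable def sectionFunctor (I : Ideal R) : ModuleCat.{u} R ⥤ ModuleCat.{u} R where
  obj X := ModuleCat.of R (powTorsion I X)
  map f := ModuleCat.ofHom (f.hom.restrict fun _ hx => map_mem_powTorsion I f.hom hx)

instance (I : Ideal R) : (sectionFunctor I).Additive where

/-- The `i`-th local cohomology module `H^i_I(X)`, the `i`-th right derived functor of `Γ_I`. -/
noncomputable abbrev localCoh (I : Ideal R) (i : ℕ) (X : Type u) [AddCommGroup X] [Module R X] :
    ModuleCat.{u} R :=
  ((sectionFunctor I).rightDerived i).obj (ModuleCat.of R X)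

/-- `grade(I, X) = min {i | Ext^i_R(R/I, X) ≠ 0}`, with the value `⊤` if all of these
modules vanish. -/
noncomputable def idealGrade (I : Ideal R) (X : Type u) [AddCommGroup X] [Module R X] : ℕ∞ :=
  ⨅ i : {i : ℕ // Nontrivial (Abelian.Ext (ModuleCat.of R (R ⧸ I)) (ModuleCat.of R X) i)},
    ((i : ℕ) : ℕ∞)

end Torsion

section BaseChange

variable {R S : Type u} [CommRing R] [CommRing S] [Algebra R S]

/-- Restriction of scalars along `R → S`. -/
noncomputable abbrev restr (R S : Type u) [CommRing R] [CommRing S] [Algebra R S] :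
    ModuleCat.{u} S ⥤ ModuleCat.{u} R :=
  ModuleCat.restrictScalars (algebraMap R S)

instance [Module.Flat R S] : (ModuleCat.extendScalars.{u, u, u} (algebraMap R S)).PreservesMonomorphisms where
  preserves {X Y} f hf := by
    rw [ModuleCat.mono_iff_injective] at hf ⊢
    let e : ((restr R S).obj (ModuleCat.of S S) : Type u) ≃ₗ[R] S :=
      { toFun := fun s => s
        invFun := fun s => s
        map_add' := fun _ _ => rfl
        map_smul' := fun r s => (Algebra.smul_def (A := S) r s).symm
        left_inv := fun _ => rfl
        right_inv := fun _ => rfl }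
    have : Module.Flat R ((restr R S).obj (ModuleCat.of S S)) := Module.Flat.of_linearEquiv e
    exact Module.Flat.lTensor_preserves_injective_linearMap
      (M := (restr R S).obj (ModuleCat.of S S)) f.hom hf

instance [Module.Flat R S] : (restr R S).PreservesInjectiveObjects :=
  Functor.preservesInjectiveObjects_of_adjunction_of_preservesMonomorphisms
    (ModuleCat.extendRestrictScalarsAdj.{u, u, u} (algebraMap R S))

instance : (restr R S).PreservesHomology where

/-- Over a flat `R`-algebra `S`, an injective resolution of an `S`-module is, by restriction of
scalars, an injective resolution of the underlying `R`-module. -/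
noncomputable def restrResolution [Module.Flat R S] {Z : ModuleCat.{u} S}
    (Q : InjectiveResolution Z) : InjectiveResolution ((restr R S).obj Z) where
  cocomplex := ((restr R S).mapHomologicalComplex _).obj Q.cocomplex
  injective n :=
    inferInstanceAs (Injective ((restr R S).obj (Q.cocomplex.X n)))
  ι := (HomologicalComplex.singleMapHomologicalComplex (restr R S) _ 0).inv.app Z ≫
    ((restr R S).mapHomologicalComplex _).map Q.ι
  quasiIso := inferInstance

/-- The identity, as a map from the `I`-power torsion of an `S`-module to its
`IS`-power torsion. -/
noncomputable def sectionRestr (I : Ideal R) :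
    restr R S ⋙ sectionFunctor I ⟶
      sectionFunctor (I.map (algebraMap R S)) ⋙ restr R S where
  app X := ModuleCat.ofHom
    (Y := (restr R S).obj ((sectionFunctor (I.map (algebraMap R S))).obj X))
    { toFun := fun x => ⟨x.1, by
        obtain ⟨n, hn⟩ := x.2
        refine ⟨n, fun a ha => ?_⟩
        rw [← Ideal.map_pow] at ha
        induction ha using Submodule.span_induction with
        | mem y hy => obtain ⟨r, hr, rfl⟩ := hy; exact hn r hr
        | zero => exact zero_smul S _
        | add y z _ _ hy hz => exact (add_smul y z _).trans (by rw [hy, hz, add_zero])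
        | smul s y _ hy => exact (mul_smul s y _).trans (by rw [hy]; exact smul_zero s)⟩
      map_add' := fun _ _ => rfl
      map_smul' := fun _ _ => rfl }
  naturality _ _ _ := rfl

/-- The canonical map from local cohomology over `R` of an `S`-module to local cohomology
over `S`, computed on an injective resolution `Q` over `S`. -/
noncomputable def localCohRestr [Module.Flat R S] (I : Ideal R) (i : ℕ) (Z : ModuleCat.{u} S) :
    ((sectionFunctor I).rightDerived i).obj ((restr R S).obj Z) ⟶
      (restr R S).obj
        (((sectionFunctor (I.map (algebraMap R S))).rightDerived i).obj Z) :=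
  let Q := injectiveResolution Z
  let ΓQ := ((sectionFunctor (I.map (algebraMap R S))).mapHomologicalComplex _).obj Q.cocomplex
  ((restrResolution (R := R) Q).isoRightDerivedObj (sectionFunctor I) i).hom ≫
    HomologicalComplex.homologyMap
      ((NatTrans.mapHomologicalComplex (sectionRestr (S := S) I) (ComplexShape.up ℕ)).app
        Q.cocomplex) i ≫
    ((ΓQ.sc i).mapHomologyIso (restr R S)).hom ≫
    (restr R S).map
      (Q.isoRightDerivedObj (sectionFunctor (I.map (algebraMap R S))) i).inv

/-- The map `H^i_I(X) → H^i_{IS}(Y)` induced by an `R`-linear map `f` from an `R`-module `X`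
to an `S`-module `Y`. -/
noncomputable def localCohMap [Module.Flat R S] (I : Ideal R) (i : ℕ)
    {X Y : Type u} [AddCommGroup X] [Module R X] [AddCommGroup Y] [Module R Y] [Module S Y]
    [IsScalarTower R S Y] (f : X →ₗ[R] Y) :
    localCoh I i X →ₛₗ[algebraMap R S] localCoh (I.map (algebraMap R S)) i Y :=
  let f' : ModuleCat.of R X ⟶ (restr R S).obj (ModuleCat.of S Y) :=
    ModuleCat.ofHom (Y := (restr R S).obj (ModuleCat.of S Y))
      { toFun := fun x => f x
        map_add' := f.map_add
        map_smul' := fun r x => (f.map_smul r x).trans (algebraMap_smul S r (f x)).symm }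
  let h := ((sectionFunctor I).rightDerived i).map f' ≫ localCohRestr I i (ModuleCat.of S Y)
  { toFun := fun x => h.hom x
    map_add' := h.hom.map_add
    map_smul' := h.hom.map_smul }

end BaseChange

section Hull

variable {R : Type u} [CommRing R]

/-- `j : N → E` is an injective hull of `N`: `E` is injective and `j` is an essential
monomorphism. -/
structure IsInjectiveHull {N E : Type u} [AddCommGroup N] [Module R N] [AddCommGroup E]
    [Module R E] (j : N →ₗ[R] E) : Prop where
  injective_module : Module.Injective R E
  injective : Function.Injective j
  essential : ∀ P : Submodule R E, P ⊓ LinearMap.range j = ⊥ → P = ⊥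

/-- Every module has an injective hull. -/
theorem exists_injectiveHull (N : Type u) [AddCommGroup N] [Module R N] :
    ∃ (E : Type u) (_ : AddCommGroup E) (_ : Module R E) (j : N →ₗ[R] E),
      IsInjectiveHull j := by
  obtain ⟨J, hJ, i, hi⟩ : ∃ J : ModuleCat.{u} R, Module.Injective R J ∧
      ∃ i : N →ₗ[R] J, Function.Injective i := by
    refine ⟨Injective.under (ModuleCat.of R N), ?_, (Injective.ι (ModuleCat.of R N)).hom, ?_⟩
    · exact Module.injective_module_of_injective_object (inj := inferInstanceAs
        (Injective (Injective.under (ModuleCat.of R N))))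
    · exact (ModuleCat.mono_iff_injective _).1 inferInstance
  let s : Set (Submodule R J) := {L | LinearMap.range i ≤ L ∧
    ∀ P ≤ L, P ⊓ LinearMap.range i = ⊥ → P = ⊥}
  -- a maximal essential extension of `N` inside `J`
  obtain ⟨L, -, hL⟩ := zorn_le_nonempty₀ s (by
    intro c hc hch y hy
    refine ⟨sSup c, ⟨(hc hy).1.trans (le_sSup hy), fun P hP hPi => ?_⟩, fun z hz => le_sSup hz⟩
    rw [eq_bot_iff]
    intro x hx
    obtain ⟨z, hz, hxz⟩ := (Submodule.mem_sSup_of_directed ⟨y, hy⟩ hch.directedOn).1 (hP hx)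
    have h1 := (hc hz).2 (Submodule.span R {x}) (by simpa using hxz) (by
      rw [eq_bot_iff, ← hPi]
      exact inf_le_inf_right _ (by simpa using hx))
    simpa using h1) (LinearMap.range i) ⟨le_rfl, fun P hP h => by rwa [inf_eq_left.2 hP] at h⟩
  -- a maximal complement
  obtain ⟨C, -, hC⟩ := zorn_le_nonempty₀ {C : Submodule R J | C ⊓ L = ⊥} (by
    intro c hc hch y hy
    refine ⟨sSup c, ?_, fun z hz => le_sSup hz⟩
    change sSup c ⊓ L = ⊥
    rw [eq_bot_iff]
    rintro x ⟨hx, hxL⟩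
    obtain ⟨z, hz, hxz⟩ := (Submodule.mem_sSup_of_directed ⟨y, hy⟩ hch.directedOn).1 hx
    rw [← (hc hz : z ⊓ L = ⊥)]
    exact ⟨hxz, hxL⟩) ⊥ (by simp)
  have hCL : C ⊓ L = ⊥ := hC.prop
  have hq : Function.Injective (C.mkQ ∘ₗ L.subtype) := by
    rw [← LinearMap.ker_eq_bot, eq_bot_iff]
    intro x hx
    have : (x : J) ∈ C ⊓ L := ⟨by simpa using hx, x.2⟩
    rw [hCL] at this
    simpa using this
  obtain ⟨h, hh⟩ := hJ.out (C.mkQ ∘ₗ L.subtype) hq L.subtype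
  have hh' : ∀ x ∈ L, h (C.mkQ x) = x := fun x hx => hh ⟨x, hx⟩
  -- `L → J / C` is essential, so `h` is injective
  have hess : ∀ P : Submodule R (J ⧸ C), P ⊓ L.map C.mkQ = ⊥ → P = ⊥ := by
    intro P hP
    have h1 : P.comap C.mkQ ∈ {C : Submodule R J | C ⊓ L = ⊥} := by
      change _ ⊓ _ = _
      rw [eq_bot_iff]
      rintro x ⟨hx, hxL⟩
      have : C.mkQ x ∈ P ⊓ L.map C.mkQ := ⟨hx, x, hxL, rfl⟩
      rw [hP] at this
      rw [← hCL]
      exact ⟨by simpa using this, hxL⟩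
    have h2 : C ≤ P.comap C.mkQ := by
      intro x hx
      have : C.mkQ x = 0 := by simpa using hx
      simp [Submodule.mem_comap, this]
    have h3 := hC.le_of_ge h1 h2
    rw [eq_bot_iff]
    intro y hy
    obtain ⟨x, rfl⟩ := C.mkQ_surjective y
    have h4 : x ∈ P.comap C.mkQ := hy
    simpa using h3 h4
  have hinj : Function.Injective h := by
    rw [← LinearMap.ker_eq_bot]
    refine hess _ ?_
    rw [eq_bot_iff]
    rintro _ ⟨hy, x, hx, rfl⟩
    have := hh' x hx
    rw [LinearMap.mem_ker.1 hy] at this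
    simp [← this]
  have hLr : L ≤ LinearMap.range h := fun x hx => ⟨_, hh' x hx⟩
  have hrange : LinearMap.range h = L := by
    refine le_antisymm (hL.le_of_ge ⟨hL.prop.1.trans hLr, ?_⟩ hLr) hLr
    intro P hP hPi
    have h1 : P ⊓ L = ⊥ := hL.prop.2 _ inf_le_right (by
      rw [inf_assoc, inf_eq_right.2 hL.prop.1, hPi])
    have h2 : P.comap h = ⊥ := by
      refine hess _ ?_
      rw [eq_bot_iff]
      rintro _ ⟨hy, x, hx, rfl⟩
      have hy' : h (C.mkQ x) ∈ P := hy
      rw [hh' x hx] at hy'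
      have : x ∈ P ⊓ L := ⟨hy', hx⟩
      rw [h1] at this
      simp [(Submodule.mem_bot R).1 this]
    rw [eq_bot_iff]
    intro x hx
    obtain ⟨y, rfl⟩ := hP hx
    have : y ∈ P.comap h := hx
    rw [h2] at this
    simp [(Submodule.mem_bot R).1 this]
  -- so `L` is a direct summand of `J`
  let p : J →ₗ[R] L := (h ∘ₗ C.mkQ).codRestrict L fun x => by
    rw [← hrange]; exact ⟨_, rfl⟩
  have hp : ∀ x : L, p x = x := fun x => Subtype.ext (hh' x x.2)
  refine ⟨L, inferInstance, inferInstance,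
    i.codRestrict L fun x => hL.prop.1 ⟨x, rfl⟩, ?_, ?_, ?_⟩
  · refine ⟨fun X Y _ _ _ _ f hf g => ?_⟩
    obtain ⟨k, hk⟩ := hJ.out f hf (L.subtype ∘ₗ g)
    exact ⟨p ∘ₗ k, fun x => by
      rw [LinearMap.comp_apply, hk]; exact hp (g x)⟩
  · intro x y hxy
    exact hi (congrArg Subtype.val hxy)
  · intro P hP
    have h1 : P.map L.subtype = ⊥ := by
      refine hL.prop.2 _ (Submodule.map_subtype_le L P) ?_
      rw [eq_bot_iff]
      rintro _ ⟨⟨x, hx, rfl⟩, y, hy⟩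
      have : x ∈ P ⊓ LinearMap.range (i.codRestrict L fun x => hL.prop.1 ⟨x, rfl⟩) :=
        ⟨hx, y, Subtype.ext hy⟩
      rw [hP] at this
      simp [(Submodule.mem_bot R).1 this]
    rw [eq_bot_iff]
    intro x hx
    have : (x : J) ∈ P.map L.subtype := ⟨x, hx, rfl⟩
    rw [h1] at this
    simpa using this

end Hull

section Matlis

variable (R : Type u) [CommRing R] [IsLocalRing R]

/-- `E_R(𝕜)`: an injective hull of the residue field of the local ring `R`. -/
def ResidueHull : Type u := (exists_injectiveHull (R := R) (IsLocalRing.ResidueField R)).choose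

noncomputable instance : AddCommGroup (ResidueHull R) :=
  (exists_injectiveHull (R := R) (IsLocalRing.ResidueField R)).choose_spec.choose

noncomputable instance : Module R (ResidueHull R) :=
  (exists_injectiveHull (R := R) (IsLocalRing.ResidueField R)).choose_spec.choose_spec.choose

theorem exists_isInjectiveHull_residueHull :
    ∃ j : IsLocalRing.ResidueField R →ₗ[R] ResidueHull R, IsInjectiveHull j :=
  (exists_injectiveHull (R := R)
    (IsLocalRing.ResidueField R)).choose_spec.choose_spec.choose_spec

variable {R} in
/-- Over a Noetherian ring, every element of `E_R(𝕜)` is killed by a power of `𝔪`. -/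
theorem exists_pow_smul_eq_zero [IsNoetherianRing R] (x : ResidueHull R) :
    ∃ n : ℕ, ∀ a ∈ IsLocalRing.maximalIdeal R ^ n, a • x = 0 := by
  obtain ⟨j, hj⟩ := exists_isInjectiveHull_residueHull R
  let X : Submodule R (ResidueHull R) := Submodule.span R {x}
  have key : IsLocalRing.maximalIdeal R ≤ (Module.annihilator R X).radical := by
    rw [← Ideal.sInf_minimalPrimes, le_sInf_iff]
    intro p hp
    have hp' := Module.associatedPrimes.minimalPrimes_annihilator_subset_associatedPrimes R X hp
    obtain ⟨hprime, y, hy⟩ := isAssociatedPrime_iff.1 hp'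
    have hy' : ∀ r : R, r ∈ p ↔ r • y = 0 := fun r => by
      rw [hy, Submodule.mem_colon_singleton, Submodule.mem_bot]
    have hy0 : Submodule.span R {(y : ResidueHull R)} ⊓ LinearMap.range j ≠ ⊥ := by
      intro h
      have h1 := hj.essential _ h
      have h2 : y = 0 := Subtype.ext (by simpa using h1)
      exact hprime.ne_top ((Ideal.eq_top_iff_one p).2 ((hy' 1).2 (by rw [h2, smul_zero])))
    obtain ⟨z, ⟨hz1, k, hk⟩, hz⟩ := Submodule.exists_mem_ne_zero_of_ne_bot hy0
    obtain ⟨r, rfl⟩ := Submodule.mem_span_singleton.1 hz1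
    intro t ht
    have htk : t • k = 0 := by
      rw [Algebra.smul_def, IsLocalRing.ResidueField.algebraMap_eq,
        (IsLocalRing.residue_eq_zero_iff t).2 ht, zero_mul]
    have h1 : t * r ∈ p := by
      refine (hy' _).2 (Subtype.ext ?_)
      change (t * r) • (y : ResidueHull R) = 0
      rw [mul_smul, ← hk, ← map_smul, htk, map_zero]
    refine (hprime.mem_or_mem h1).resolve_right fun hr => hz ?_
    exact congrArg Subtype.val ((hy' r).1 hr)
  obtain ⟨n, hn⟩ := Ideal.exists_pow_le_of_le_radical_of_fg key
    (IsNoetherian.noetherian _)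
  refine ⟨n, fun a ha => ?_⟩
  have := Module.mem_annihilator.1 (hn ha) ⟨x, Submodule.mem_span_singleton_self x⟩
  exact congrArg Subtype.val this

open IsLocalRing

/-- The ring `R̂`, the `𝔪`-adic completion of the local ring `R`. -/
abbrev ComplRing (R : Type u) [CommRing R] [IsLocalRing R] : Type u :=
  AdicCompletion (maximalIdeal R) R

variable {R}

theorem smul_eq_smul_of_mk_eq {n : ℕ} {x : ResidueHull R}
    (hx : ∀ a ∈ maximalIdeal R ^ n, a • x = 0) {r s : R}
    (h : Ideal.Quotient.mk (maximalIdeal R ^ n) r = Ideal.Quotient.mk (maximalIdeal R ^ n) s) :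
    r • x = s • x := by
  rw [← sub_eq_zero, ← sub_smul]
  exact hx _ (Ideal.Quotient.eq.1 h)

theorem exists_compl_eq (n : ℕ) (a : ComplRing R) : ∃ r : R,
    AdicCompletion.evalₐ (maximalIdeal R) n a = Ideal.Quotient.mk (maximalIdeal R ^ n) r :=
  (Ideal.Quotient.mk_surjective _).imp fun _ h => h.symm

variable [IsNoetherianRing R]

/-- An element `a ∈ R̂` acts on `x ∈ E_R(𝕜)` with `𝔪ⁿ x = 0` as any `r ∈ R` with the
same class in `R / 𝔪ⁿ`. -/
noncomputable instance : SMul (ComplRing R) (ResidueHull R) where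
  smul a x := Quotient.out (AdicCompletion.evalₐ (maximalIdeal R)
    (exists_pow_smul_eq_zero x).choose a) • x

theorem compl_smul_eq {n : ℕ} {x : ResidueHull R}
    (hx : ∀ a ∈ maximalIdeal R ^ n, a • x = 0) {a : ComplRing R} {r : R}
    (h : AdicCompletion.evalₐ (maximalIdeal R) n a = Ideal.Quotient.mk (maximalIdeal R ^ n) r) :
    a • x = r • x := by
  obtain ⟨f, rfl⟩ := AdicCompletion.mk_surjective (maximalIdeal R) R a
  have hk := (exists_pow_smul_eq_zero x).choose_spec
  change Quotient.out (AdicCompletion.evalₐ (maximalIdeal R)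
    (exists_pow_smul_eq_zero x).choose _) • x = r • x
  generalize (exists_pow_smul_eq_zero x).choose = k at hk ⊢
  rw [AdicCompletion.evalₐ_mk] at h ⊢
  rw [smul_eq_smul_of_mk_eq hk (s := f.val k) (Ideal.Quotient.mk_out _),
    ← smul_eq_smul_of_mk_eq hk
      (AdicCompletion.Ideal.mk_eq_mk (maximalIdeal R) (Nat.le_add_left k n) f)]
  exact smul_eq_smul_of_mk_eq hx
    ((AdicCompletion.Ideal.mk_eq_mk (maximalIdeal R) (Nat.le_add_right n k) f).trans h)

noncomputable instance : Module (ComplRing R) (ResidueHull R) where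
  one_smul x := by
    obtain ⟨n, hn⟩ := exists_pow_smul_eq_zero x
    rw [compl_smul_eq hn (r := 1) (by simp), one_smul]
  mul_smul a b x := by
    obtain ⟨n, hn⟩ := exists_pow_smul_eq_zero x
    obtain ⟨r, hr⟩ := exists_compl_eq n a
    obtain ⟨s, hs⟩ := exists_compl_eq n b
    rw [compl_smul_eq hn hs, compl_smul_eq (r := r * s) hn (by simp [hr, hs]), mul_smul,
      compl_smul_eq (n := n) (fun c hc => by rw [smul_comm, hn c hc, smul_zero]) hr]
  smul_zero a := compl_smul_eq (n := 0) (by simp) (exists_compl_eq 0 a).choose_spec |>.trans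
    (smul_zero _)
  smul_add a x y := by
    obtain ⟨m, hm⟩ := exists_pow_smul_eq_zero x
    obtain ⟨n, hn⟩ := exists_pow_smul_eq_zero y
    have hm' : ∀ c ∈ maximalIdeal R ^ (m + n), c • x = 0 := fun c hc =>
      hm c (Ideal.pow_le_pow_right (Nat.le_add_right m n) hc)
    have hn' : ∀ c ∈ maximalIdeal R ^ (m + n), c • y = 0 := fun c hc =>
      hn c (Ideal.pow_le_pow_right (Nat.le_add_left n m) hc)
    obtain ⟨r, hr⟩ := exists_compl_eq (m + n) a
    rw [compl_smul_eq hm' hr, compl_smul_eq hn' hr, ← smul_add]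
    exact compl_smul_eq (fun c hc => by rw [smul_add, hm' c hc, hn' c hc, add_zero]) hr
  add_smul a b x := by
    obtain ⟨n, hn⟩ := exists_pow_smul_eq_zero x
    obtain ⟨r, hr⟩ := exists_compl_eq n a
    obtain ⟨s, hs⟩ := exists_compl_eq n b
    rw [compl_smul_eq hn hr, compl_smul_eq hn hs, ← add_smul]
    exact compl_smul_eq hn (by simp [hr, hs])
  zero_smul x := by
    obtain ⟨n, hn⟩ := exists_pow_smul_eq_zero x
    rw [compl_smul_eq hn (r := 0) (by simp), zero_smul]

instance : IsScalarTower R (ComplRing R) (ResidueHull R) where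
  smul_assoc r a x := by
    obtain ⟨n, hn⟩ := exists_pow_smul_eq_zero x
    obtain ⟨s, hs⟩ := exists_compl_eq n a
    rw [compl_smul_eq hn hs, smul_smul]
    exact compl_smul_eq hn (by rw [map_smul, hs]; rfl)

end Matlis
section Statement

variable {R : Type u} [CommRing R] [IsLocalRing R]

/-- The Matlis dual `D(X) = Hom_R(X, E_R(𝕜))`. -/
abbrev MatlisDual (R : Type u) [CommRing R] [IsLocalRing R] (X : Type u) [AddCommGroup X]
    [Module R X] : Type u :=
  X →ₗ[R] ResidueHull R

/-- The evaluation map `X ⊗ D(X) → E_R(𝕜)`, `x ⊗ f ↦ f x`. -/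
noncomputable def evalMap (R : Type u) [CommRing R] [IsLocalRing R] (X : Type u)
    [AddCommGroup X] [Module R X] : TensorProduct R X (MatlisDual R X) →ₗ[R] ResidueHull R :=
  TensorProduct.lift LinearMap.applyₗ

/-- The completion `M̂`. -/
abbrev ComplModule (R : Type u) [CommRing R] [IsLocalRing R] (M : Type u) [AddCommGroup M]
    [Module R M] : Type u :=
  AdicCompletion (IsLocalRing.maximalIdeal R) M

/-- The extended ideal `I R̂`. -/
noncomputable abbrev complIdeal (I : Ideal R) : Ideal (ComplRing R) :=
  I.map (algebraMap R (ComplRing R))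

/-- The natural map `H^i_I(M) → H^i_{IR̂}(M̂)`, induced by `M → M̂`. -/
noncomputable def localCohCompl [IsNoetherianRing R] (I : Ideal R) (i : ℕ) (M : Type u)
    [AddCommGroup M] [Module R M] :
    localCoh I i M →ₛₗ[algebraMap R (ComplRing R)] localCoh (complIdeal I) i (ComplModule R M) :=
  localCohMap I i (AdicCompletion.of (IsLocalRing.maximalIdeal R) M)

end Statement

end LocCoh

/-!
Let `E = E_R(𝕜)`, `D = Hom_R(-, E)`, `H = H^g_I(M)` and `Ĥ = H^g_{IR̂}(M̂)`.

*Flat base change.* `R̂` is flat over `R` and `M̂ = R̂ ⊗ M`, so `R̂ ⊗ H ≅ Ĥ`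
(`baseChangeLocalCoh_bijective`): for an injective resolution `P` of `M`, the complex `R̂ ⊗ P` is
an injective resolution of `R̂ ⊗ M` over `R`, and `Γ_I` commutes with `R̂ ⊗ -`. Hence `R`-linear maps
`H → E` are the same as `R̂`-linear maps `Ĥ → E` (`extendEquiv`), and an endomorphism of `Ĥ` can be
transposed to one of `D(H)`.

*Finiteness.* As `Ext^i_R(R/I, M) = 0` for `i < g`, a class in `H` killed by `Iⁿ` is represented by
a cocycle killed by `Iⁿ`. So `0 :_H Iⁿ` is a quotient of `Ext^g_R(R/Iⁿ, M)` and is finite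
(`fg_annihilated_localCoh`). For this it is enough that `g` is at most the grade.

*Matlis duality.* `R̂ ≅ Hom_R(E, E)` (`toModuleEnd_residueHull_bijective`), and it follows that
`R̂ ⊗ N ≅ D(D(N))` for every finite module `N`, while `R̂ ⊗ X → D(D(X))` is injective for every `X`.
An element of `D(D(X))` killed by an ideal `J` vanishes on the linear forms that are zero on
`0 :_X J`, since these lie in `J D(X)`; so it comes from `R̂ ⊗ (0 :_X J)` when `0 :_X J` is finite
(`exists_evalTensor_eq_of_smul_eq_zero`).

*Transposition.* Injectivity of `Ĥ → D(D(H))` makes transposition injective. For `ψ` in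
`End_R(D(H))` and `x` in `H`, the functional `f ↦ ψ(f)(x)` is killed by the power of `I` that kills
`x`, so it is evaluation at an element of `Ĥ`. These elements depend linearly on `x`, which gives an
endomorphism of `Ĥ` with transpose `ψ` (`transpose_localCoh_bijective`).

*The three conditions.* Transposition respects multiplication by elements of `R̂`. And the action
`R̂ → End_R(D(H))` is the dual of the evaluation map `H ⊗ D(H) → E`, under `R̂ ≅ Hom_R(E, E)` and
`Hom_R(H ⊗ D(H), E) ≅ End_R(D(H))`. As `E` is an injective cogenerator, one of these maps is
bijective exactly if the other is (`evalMap_bijective_iff`).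
-/

namespace LocCoh

open scoped TensorProduct
open IsLocalRing

/-! ### Cohomology classes of cocycles in complexes of modules -/

section Homology

theorem homologyπ_mapHomologyIso_hom {C D : Type*} [Category C] [Category D]
    [Limits.HasZeroMorphisms C] [Limits.HasZeroMorphisms D] (S : ShortComplex C) (F : C ⥤ D)
    [F.PreservesZeroMorphisms] [S.HasHomology] [(S.map F).HasHomology]
    [F.PreservesLeftHomologyOf S] :
    (S.map F).homologyπ ≫ (S.mapHomologyIso F).hom =
      (S.mapCyclesIso F).hom ≫ F.map S.homologyπ := by
  let h := S.homologyData.left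
  rw [h.mapHomologyIso_eq F, h.mapCyclesIso_eq F]
  have h₁ : (S.map F).homologyπ ≫ (h.map F).homologyIso.hom =
      (h.map F).cyclesIso.hom ≫ F.map h.π :=
    (h.map F).homologyπ_comp_homologyIso_hom
  have h₂ : F.map h.π ≫ F.map h.homologyIso.inv = F.map h.cyclesIso.inv ≫ F.map S.homologyπ := by
    rw [← F.map_comp, ← F.map_comp, h.π_comp_homologyIso_inv]
  exact (Category.assoc _ _ _).symm.trans ((congrArg (· ≫ F.map h.homologyIso.inv) h₁).trans
    ((Category.assoc _ _ _).trans ((congrArg ((h.map F).cyclesIso.hom ≫ ·) h₂).trans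
      (Category.assoc _ _ _).symm)))

variable {R : Type u} [CommRing R]

/-- The inclusion of the kernel of a differential into the categorical object of cycles. -/
noncomputable def kerToCycles (K : CochainComplex (ModuleCat.{u} R) ℕ) (i : ℕ) :
    ModuleCat.of R (LinearMap.ker (K.d i (i + 1)).hom) ⟶ K.cycles i :=
  K.liftCycles (ModuleCat.ofHom (Submodule.subtype _)) (i + 1) (by simp) (by ext x; exact x.2)

theorem iCycles_kerToCycles (K : CochainComplex (ModuleCat.{u} R) ℕ) (i : ℕ)
    (z : LinearMap.ker (K.d i (i + 1)).hom) :
    (K.iCycles i).hom ((kerToCycles K i).hom z) = z :=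
  ConcreteCategory.congr_hom (K.liftCycles_i
    (ModuleCat.ofHom (LinearMap.ker (K.d i (i + 1)).hom).subtype) (i + 1) (by simp)
    (by ext x; exact x.2)) z

/-- The class of a cocycle, as a linear map onto the cohomology of a cochain complex of modules. -/
noncomputable def homologyClass (K : CochainComplex (ModuleCat.{u} R) ℕ) (i : ℕ) :
    LinearMap.ker (K.d i (i + 1)).hom →ₗ[R] K.homology i :=
  (K.homologyπ i).hom ∘ₗ (kerToCycles K i).hom

theorem homologyClass_eq (K : CochainComplex (ModuleCat.{u} R) ℕ) (i : ℕ) (c : K.cycles i)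
    (z : LinearMap.ker (K.d i (i + 1)).hom) (h : (K.iCycles i).hom c = z) :
    homologyClass K i z = (K.homologyπ i).hom c :=
  congrArg (K.homologyπ i).hom ((ModuleCat.mono_iff_injective (K.iCycles i)).1 inferInstance
    ((iCycles_kerToCycles K i z).trans h.symm))

theorem homologyClass_surjective (K : CochainComplex (ModuleCat.{u} R) ℕ) (i : ℕ) :
    Function.Surjective (homologyClass K i) := by
  intro h
  obtain ⟨c, rfl⟩ := (ModuleCat.epi_iff_surjective (K.homologyπ i)).1 inferInstance h
  refine ⟨⟨(K.iCycles i).hom c, ?_⟩, homologyClass_eq K i c _ rfl⟩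
  exact ConcreteCategory.congr_hom (K.iCycles_d i (i + 1)) c

theorem homologyClass_eq_zero_iff (K : CochainComplex (ModuleCat.{u} R) ℕ) (i : ℕ)
    (z : LinearMap.ker (K.d i (i + 1)).hom) :
    homologyClass K i z = 0 ↔ ∃ j, ∃ y : K.X j, (K.d j i).hom y = z := by
  obtain ⟨c, hc⟩ : ∃ c : K.cycles i, (K.iCycles i).hom c = z := ⟨_, iCycles_kerToCycles K i z⟩
  rw [homologyClass_eq K i c z hc]
  constructor
  · intro h
    let S := ShortComplex.mk (K.toCycles ((ComplexShape.up ℕ).prev i) i) (K.homologyπ i) (by simp)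
    have hS : S.Exact := ShortComplex.exact_of_g_is_cokernel _ (K.homologyIsCokernel _ i rfl)
    obtain ⟨y, hy⟩ := (ShortComplex.moduleCat_exact_iff S).1 hS c h
    refine ⟨_, y, ?_⟩
    rw [← K.toCycles_i, ← hc]
    exact congrArg (K.iCycles i).hom hy
  · rintro ⟨j, y, hy⟩
    have : c = (K.toCycles j i).hom y := by
      apply (ModuleCat.mono_iff_injective (K.iCycles i)).1 inferInstance
      exact hc.trans (hy.symm.trans (ConcreteCategory.congr_hom (K.toCycles_i j i) y).symm)
    rw [this]
    exact ConcreteCategory.congr_hom (K.toCycles_comp_homologyπ j i) y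

theorem homologyMap_homologyClass {K L : CochainComplex (ModuleCat.{u} R) ℕ} (φ : K ⟶ L) (i : ℕ)
    (z : LinearMap.ker (K.d i (i + 1)).hom) (w : LinearMap.ker (L.d i (i + 1)).hom)
    (h : (φ.f i).hom z = w) :
    (HomologicalComplex.homologyMap φ i).hom (homologyClass K i z) = homologyClass L i w := by
  obtain ⟨c, hc⟩ : ∃ c : K.cycles i, (K.iCycles i).hom c = z := ⟨_, iCycles_kerToCycles K i z⟩
  have hw : (L.iCycles i).hom ((HomologicalComplex.cyclesMap φ i).hom c) = w :=
    (ConcreteCategory.congr_hom (HomologicalComplex.cyclesMap_i φ i) c).trans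
      ((congrArg (φ.f i).hom hc).trans h)
  rw [homologyClass_eq K i c z hc, homologyClass_eq L i _ w hw]
  exact ConcreteCategory.congr_hom (HomologicalComplex.homologyπ_naturality φ i) c

end Homology

/-! ### Local cohomology classes of torsion cocycles -/

section CocycleClass

variable {R : Type u} [CommRing R]

/-- The `I`-power torsion cocycles in degree `i` of an injective resolution. -/
noncomputable def torsionCocycles (I : Ideal R) {X : ModuleCat.{u} R} (P : InjectiveResolution X)
    (i : ℕ) : Submodule R (P.cocomplex.X i) :=
  powTorsion I (P.cocomplex.X i) ⊓ LinearMap.ker (P.cocomplex.d i (i + 1)).hom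

/-- The complex `Γ_I(P)` for an injective resolution `P`. -/
noncomputable abbrev torsionComplex (I : Ideal R) {X : ModuleCat.{u} R}
    (P : InjectiveResolution X) : CochainComplex (ModuleCat.{u} R) ℕ :=
  ((sectionFunctor I).mapHomologicalComplex _).obj P.cocomplex

/-- A torsion cocycle of `P`, seen as a cocycle of `Γ_I(P)`. -/
noncomputable def toKer (I : Ideal R) {X : ModuleCat.{u} R} (P : InjectiveResolution X) (i : ℕ) :
    torsionCocycles I P i →ₗ[R] LinearMap.ker ((torsionComplex I P).d i (i + 1)).hom where
  toFun z := ⟨(⟨z.1, z.2.1⟩ : powTorsion I (P.cocomplex.X i)), Subtype.ext z.2.2⟩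
  map_add' _ _ := rfl
  map_smul' _ _ := rfl

/-- The class in `H^i_I(X)` of a torsion cocycle of an injective resolution of `X`. -/
noncomputable def cocycleClass (I : Ideal R) {X : ModuleCat.{u} R} (P : InjectiveResolution X)
    (i : ℕ) : torsionCocycles I P i →ₗ[R] ((sectionFunctor I).rightDerived i).obj X :=
  (P.isoRightDerivedObj (sectionFunctor I) i).inv.hom ∘ₗ
    homologyClass (torsionComplex I P) i ∘ₗ toKer I P i

theorem isoRightDerivedObj_hom_cocycleClass (I : Ideal R) {X : ModuleCat.{u} R}
    (P : InjectiveResolution X) (i : ℕ) (z : torsionCocycles I P i) :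
    (P.isoRightDerivedObj (sectionFunctor I) i).hom.hom (cocycleClass I P i z) =
      homologyClass (torsionComplex I P) i (toKer I P i z) :=
  ConcreteCategory.congr_hom (P.isoRightDerivedObj (sectionFunctor I) i).inv_hom_id _

theorem iso_inv_injective {X Y : ModuleCat.{u} R} (e : X ≅ Y) : Function.Injective e.inv.hom :=
  (ModuleCat.mono_iff_injective e.inv).1 inferInstance

theorem iso_inv_surjective {X Y : ModuleCat.{u} R} (e : X ≅ Y) : Function.Surjective e.inv.hom :=
  (ModuleCat.epi_iff_surjective e.inv).1 inferInstance

theorem cocycleClass_surjective (I : Ideal R) {X : ModuleCat.{u} R} (P : InjectiveResolution X)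
    (i : ℕ) : Function.Surjective (cocycleClass I P i) := by
  intro h
  obtain ⟨h', rfl⟩ := iso_inv_surjective (P.isoRightDerivedObj (sectionFunctor I) i) h
  obtain ⟨z, rfl⟩ := homologyClass_surjective _ _ h'
  exact ⟨⟨z.1.1, z.1.2, congrArg Subtype.val z.2⟩, rfl⟩

/-- Only `j + 1 = i` matters on the right, since the other differentials into degree `i` vanish. -/
theorem cocycleClass_eq_zero_iff (I : Ideal R) {X : ModuleCat.{u} R} (P : InjectiveResolution X)
    (i : ℕ) (z : torsionCocycles I P i) :
    cocycleClass I P i z = 0 ↔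
      ∃ j, ∃ y ∈ powTorsion I (P.cocomplex.X j), (P.cocomplex.d j i).hom y = z := by
  have h₁ : cocycleClass I P i z = 0 ↔
      homologyClass (torsionComplex I P) i (toKer I P i z) = 0 :=
    map_eq_zero_iff (P.isoRightDerivedObj (sectionFunctor I) i).inv.hom (iso_inv_injective _)
  rw [h₁, homologyClass_eq_zero_iff]
  constructor
  · rintro ⟨j, y, hy⟩
    exact ⟨j, y.1, y.2, congrArg Subtype.val hy⟩
  · rintro ⟨j, y, hy, hyz⟩
    exact ⟨j, (⟨y, hy⟩ : powTorsion I (P.cocomplex.X j)), Subtype.ext hyz⟩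

/-- `H^i_I(f)` is computed on cocycles by any map of resolutions that lifts `f`. -/
theorem rightDerived_map_cocycleClass (I : Ideal R) {X Y : ModuleCat.{u} R} (f : X ⟶ Y)
    (P : InjectiveResolution X) (Q : InjectiveResolution Y) (φ : P.cocomplex ⟶ Q.cocomplex)
    (comm : P.ι.f 0 ≫ φ.f 0 = f ≫ Q.ι.f 0) (i : ℕ) (z : torsionCocycles I P i)
    (w : torsionCocycles I Q i) (h : (φ.f i).hom z = w) :
    (((sectionFunctor I).rightDerived i).map f).hom (cocycleClass I P i z) =
      cocycleClass I Q i w := by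
  apply (ModuleCat.mono_iff_injective (Q.isoRightDerivedObj (sectionFunctor I) i).hom).1
    inferInstance
  refine (ConcreteCategory.congr_hom (InjectiveResolution.isoRightDerivedObj_hom_naturality
    f P Q φ comm (sectionFunctor I) i) (cocycleClass I P i z)).trans ?_
  refine (congrArg (HomologicalComplex.homologyMap
    (((sectionFunctor I).mapHomologicalComplex _).map φ) i).hom
    (isoRightDerivedObj_hom_cocycleClass I P i z)).trans ?_
  refine Eq.trans ?_ (isoRightDerivedObj_hom_cocycleClass I Q i w).symm
  exact homologyMap_homologyClass _ _ _ _ (Subtype.ext h)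

end CocycleClass

/-! ### Local cohomology and restriction of scalars -/

section Restr

variable {R S : Type u} [CommRing R] [CommRing S] [Algebra R S]

theorem mem_powTorsion_map_iff (I : Ideal R) {Y : Type u} [AddCommGroup Y] [Module R Y]
    [Module S Y] [IsScalarTower R S Y] (y : Y) :
    y ∈ powTorsion (I.map (algebraMap R S)) Y ↔ y ∈ powTorsion I Y := by
  constructor
  · rintro ⟨n, hn⟩
    refine ⟨n, fun a ha => ?_⟩
    rw [← algebraMap_smul S a y]
    refine hn _ ?_
    rw [← Ideal.map_pow]
    exact Ideal.mem_map_of_mem _ ha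
  · rintro ⟨n, hn⟩
    refine ⟨n, fun a ha => ?_⟩
    rw [← Ideal.map_pow] at ha
    induction ha using Submodule.span_induction with
    | mem y hy => obtain ⟨r, hr, rfl⟩ := hy; rw [algebraMap_smul]; exact hn r hr
    | zero => exact zero_smul S _
    | add y z _ _ hy hz => rw [add_smul, hy, hz, add_zero]
    | smul s y _ hy => rw [smul_assoc, hy, smul_zero]

theorem mapHomologyIso_homologyClass (K : CochainComplex (ModuleCat.{u} S) ℕ) (i : ℕ)
    (z : LinearMap.ker (K.d i (i + 1)).hom)
    (w : LinearMap.ker ((((restr R S).mapHomologicalComplex _).obj K).d i (i + 1)).hom)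
    (h : (z : K.X i) = w.1) :
    ((K.sc i).mapHomologyIso (restr R S)).hom.hom
      (homologyClass (((restr R S).mapHomologicalComplex _).obj K) i w) =
    homologyClass K i z := by
  obtain ⟨c, hc⟩ : ∃ c : (((restr R S).mapHomologicalComplex _).obj K).cycles i,
    ((((restr R S).mapHomologicalComplex _).obj K).iCycles i).hom c = w :=
      ⟨_, iCycles_kerToCycles _ i w⟩
  rw [homologyClass_eq _ i c w hc]
  refine (ConcreteCategory.congr_hom
    (homologyπ_mapHomologyIso_hom (K.sc i) (restr R S)) c).trans ?_
  refine (homologyClass_eq K i (((K.sc i).mapCyclesIso (restr R S)).hom.hom c) z ?_).symm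
  refine Eq.trans ?_ (hc.trans h.symm)
  exact ConcreteCategory.congr_hom ((K.sc i).mapCyclesIso_hom_iCycles (restr R S)) c

/-- Over `R` and over `S`, the two complexes `Γ_I(Q)` and `Γ_{IS}(Q)` have the same underlying
groups; the comparison map is the identity on cocycles. -/
theorem localCohRestr_cocycleClass [Module.Flat R S] (I : Ideal R) (i : ℕ) (Z : ModuleCat.{u} S)
    (w : torsionCocycles I (restrResolution (R := R) (injectiveResolution Z)) i)
    (z : torsionCocycles (I.map (algebraMap R S)) (injectiveResolution Z) i)
    (h : w.1 = z.1) :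
    (localCohRestr I i Z).hom
      (cocycleClass I (restrResolution (R := R) (injectiveResolution Z)) i w) =
      cocycleClass (I.map (algebraMap R S)) (injectiveResolution Z) i z := by
  let Q := injectiveResolution Z
  let ΓQ := ((sectionFunctor (I.map (algebraMap R S))).mapHomologicalComplex _).obj Q.cocomplex
  let v : LinearMap.ker ((((restr R S).mapHomologicalComplex _).obj ΓQ).d i (i + 1)).hom :=
    ⟨(toKer _ Q i z).1, (toKer _ Q i z).2⟩
  have h₁ := isoRightDerivedObj_hom_cocycleClass I (restrResolution (R := R) Q) i w
  have h₂ : (HomologicalComplex.homologyMap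
      ((NatTrans.mapHomologicalComplex (sectionRestr (S := S) I) (ComplexShape.up ℕ)).app
        Q.cocomplex) i).hom
      (homologyClass (torsionComplex I (restrResolution (R := R) Q)) i
        (toKer I (restrResolution (R := R) Q) i w)) = homologyClass _ i v :=
    homologyMap_homologyClass _ _ _ _ (Subtype.ext h)
  have h₃ := mapHomologyIso_homologyClass (R := R) ΓQ i (toKer _ Q i z) v rfl
  exact congrArg (Q.isoRightDerivedObj (sectionFunctor (I.map (algebraMap R S))) i).inv.hom
    (((congrArg ((ΓQ.sc i).mapHomologyIso (restr R S)).hom.hom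
      ((congrArg _ h₁).trans h₂))).trans h₃)

end Restr

/-! ### Flat base change of injective modules and of torsion -/

section FlatInjective

variable {R S : Type u} [CommRing R] [IsNoetherianRing R] [CommRing S] [Algebra R S]
  [Module.Flat R S]

/-- If `S` is flat over `R` and `X` is an injective `R`-module, then so is `S ⊗ X`: for a
finitely presented module `J`, a map `J → S ⊗ X` is an `S`-combination of maps coming from
`J → X`, and these extend from an ideal to the whole ring. -/
theorem injective_tensorProduct (X : Type u) [AddCommGroup X] [Module R X]
    (hX : Module.Injective R X) : Module.Injective R (S ⊗[R] X) := by
  refine Module.Baer.injective fun J g => ?_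
  have : Module.FinitePresentation R J := Module.finitePresentation_of_finite R J
  have key : ∀ G : S ⊗[R] J →ₗ[S] S ⊗[R] X, ∃ g' : R →ₗ[R] S ⊗[R] X,
      ∀ j : J, g' j = G (1 ⊗ₜ j) := by
    intro G
    refine (Module.FinitePresentation.isBaseChange_map R J X S).inductionOn G _ ?_ ?_ ?_ ?_
    · exact ⟨0, fun j => rfl⟩
    · intro h
      obtain ⟨k, hk⟩ := hX.out J.subtype J.injective_subtype h
      exact ⟨TensorProduct.mk R S X 1 ∘ₗ k, fun j => by
        simpa using congrArg (fun x => (1 : S) ⊗ₜ[R] x) (hk j)⟩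
    · rintro s G ⟨k, hk⟩
      exact ⟨s • k, fun j => by simp [hk]⟩
    · rintro G₁ G₂ ⟨k₁, hk₁⟩ ⟨k₂, hk₂⟩
      exact ⟨k₁ + k₂, fun j => by simp [hk₁, hk₂]⟩
  obtain ⟨g', hg'⟩ := key (g.liftBaseChange S)
  exact ⟨g', fun x hx => by simpa using hg' ⟨x, hx⟩⟩

/-- `Γ_I` commutes with flat base change: an element killed by `Iⁿ` is a map `R/Iⁿ → S ⊗ X`, and
since `R/Iⁿ` is finitely presented it is an `S`-combination of maps `R/Iⁿ → X`. -/
theorem exists_of_mem_powTorsion_tensorProduct (I : Ideal R) {X : Type u} [AddCommGroup X]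
    [Module R X] {y : S ⊗[R] X} (hy : y ∈ powTorsion I (S ⊗[R] X)) :
    ∃ t : S ⊗[R] powTorsion I X, (powTorsion I X).subtype.lTensor S t = y := by
  obtain ⟨n, hn⟩ := hy
  have : Module.FinitePresentation R (R ⧸ I ^ n) := Module.finitePresentation_of_finite R _
  have key : ∀ G : S ⊗[R] (R ⧸ I ^ n) →ₗ[S] S ⊗[R] X, ∃ t : S ⊗[R] powTorsion I X,
      ((powTorsion I X).subtype.baseChange S t) = G (1 ⊗ₜ 1) := by
    intro G
    refine (Module.FinitePresentation.isBaseChange_map R (R ⧸ I ^ n) X S).inductionOn G _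
      ?_ ?_ ?_ ?_
    · exact ⟨0, by simp⟩
    · intro h
      refine ⟨1 ⊗ₜ ⟨h 1, n, fun a ha => ?_⟩, by simp⟩
      rw [← map_smul, Algebra.smul_def, mul_one, Ideal.Quotient.algebraMap_eq,
        Ideal.Quotient.eq_zero_iff_mem.2 ha, map_zero]
    · rintro s G ⟨k, hk⟩
      exact ⟨s • k, by simp [hk]⟩
    · rintro G₁ G₂ ⟨k₁, hk₁⟩ ⟨k₂, hk₂⟩
      exact ⟨k₁ + k₂, by simp [hk₁, hk₂]⟩
  let g : R ⧸ I ^ n →ₗ[R] S ⊗[R] X :=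
    (I ^ n).liftQ (LinearMap.toSpanSingleton R _ y) fun a ha => hn a ha
  obtain ⟨t, ht⟩ := key (g.liftBaseChange S)
  refine ⟨t, ht.trans ?_⟩
  rw [LinearMap.liftBaseChange_tmul, one_smul]
  exact (one_smul R y)

end FlatInjective

/-! ### Flat base change of injective resolutions -/

section FlatFunctor

variable (R S : Type u) [CommRing R] [CommRing S] [Algebra R S]

/-- The functor `X ↦ S ⊗ X`, with values in `R`-modules. -/
noncomputable def tensorFunctor : ModuleCat.{u} R ⥤ ModuleCat.{u} R where
  obj X := ModuleCat.of R (S ⊗[R] X)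
  map f := ModuleCat.ofHom (f.hom.lTensor S)
  map_id X := by ext; simp
  map_comp f g := by ext; simp

instance : (tensorFunctor R S).Additive where
  map_add {X Y f g} := by
    apply ModuleCat.hom_ext
    exact LinearMap.lTensor_add _ _ _

instance [Module.Flat R S] : (tensorFunctor R S).PreservesHomology :=
  Functor.preservesHomology_of_map_exact _ fun C hC => by
    rw [ShortComplex.ShortExact.moduleCat_exact_iff_function_exact] at hC ⊢
    exact Module.Flat.lTensor_exact S hC

variable {R}

/-- Over a Noetherian ring, tensoring with a flat algebra takes injective resolutions to injective
resolutions. -/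
noncomputable def tensorResolution [IsNoetherianRing R] [Module.Flat R S] {X : ModuleCat.{u} R}
    (P : InjectiveResolution X) : InjectiveResolution ((tensorFunctor R S).obj X) where
  cocomplex := ((tensorFunctor R S).mapHomologicalComplex _).obj P.cocomplex
  injective n := by
    have := injective_tensorProduct (S := S) (P.cocomplex.X n)
      (Module.injective_module_of_injective_object R (P.cocomplex.X n) (inj := P.injective n))
    exact Module.injective_object_of_injective_module R (S ⊗[R] P.cocomplex.X n)
  ι := (HomologicalComplex.singleMapHomologicalComplex (tensorFunctor R S) _ 0).inv.app X ≫
    ((tensorFunctor R S).mapHomologicalComplex _).map P.ι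
  quasiIso := inferInstance

theorem tensorResolution_ι [IsNoetherianRing R] [Module.Flat R S] {X : ModuleCat.{u} R}
    (P : InjectiveResolution X) :
    (tensorResolution S P).ι.f 0 = (tensorFunctor R S).map (P.ι.f 0) := by
  simp [tensorResolution]
  rfl

theorem restrResolution_ι [Module.Flat R S] {Z : ModuleCat.{u} S}
    (P : InjectiveResolution Z) :
    (restrResolution (R := R) P).ι.f 0 = (restr R S).map (P.ι.f 0) := by
  simp [restrResolution]
  rfl

end FlatFunctor

/-! ### Flat base change for local cohomology -/

section BaseChange

variable {R S : Type u} [CommRing R] [CommRing S] [Algebra R S]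
  {X Y : Type u} [AddCommGroup X] [Module R X] [AddCommGroup Y] [Module R Y] [Module S Y]
  [IsScalarTower R S Y]

/-- An `R`-linear map into an `S`-module, as a morphism into its restriction of scalars. -/
noncomputable def toRestr (f : X →ₗ[R] Y) : ModuleCat.of R X ⟶ (restr R S).obj (ModuleCat.of S Y) :=
  ModuleCat.ofHom (Y := (restr R S).obj (ModuleCat.of S Y))
    { toFun := fun x => f x
      map_add' := f.map_add
      map_smul' := fun r x => (f.map_smul r x).trans (algebraMap_smul S r (f x)).symm }

theorem isScalarTower_compHom (B : ModuleCat.{u} S) :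
    letI : Module R B := Module.compHom _ (algebraMap R S)
    IsScalarTower R S B :=
  letI : Module R B := Module.compHom _ (algebraMap R S)
  ⟨fun r s x => by rw [Algebra.smul_def, mul_smul]; rfl⟩

/-- The `S`-linear extension `S ⊗ A → B` of an `R`-linear map from `A` to an `S`-module `B`. -/
noncomputable def extendLinear {A : ModuleCat.{u} R} {B : ModuleCat.{u} S}
    (a : A ⟶ (restr R S).obj B) : S ⊗[R] A →ₗ[S] B :=
  letI : Module R B := Module.compHom _ (algebraMap R S)
  haveI : IsScalarTower R S B := isScalarTower_compHom B
  LinearMap.liftBaseChange S (show A →ₗ[R] B from a.hom)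

theorem extendLinear_tmul {A : ModuleCat.{u} R} {B : ModuleCat.{u} S}
    (a : A ⟶ (restr R S).obj B) (s : S) (x : A) :
    extendLinear a (s ⊗ₜ x) = s • (show B from a.hom x) :=
  letI : Module R B := Module.compHom _ (algebraMap R S)
  haveI : IsScalarTower R S B := isScalarTower_compHom B
  LinearMap.liftBaseChange_tmul S (show A →ₗ[R] B from a.hom) _ _

/-- `extendLinear` as a morphism of `R`-modules. -/
noncomputable def extendHom {A : ModuleCat.{u} R} {B : ModuleCat.{u} S}
    (a : A ⟶ (restr R S).obj B) : (tensorFunctor R S).obj A ⟶ (restr R S).obj B :=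
  letI : Module R B := Module.compHom _ (algebraMap R S)
  haveI : IsScalarTower R S B := isScalarTower_compHom B
  ModuleCat.ofHom (X := S ⊗[R] A) (Y := B) ((extendLinear a).restrictScalars R)

theorem map_comp_extendHom {A A' : ModuleCat.{u} R} {B : ModuleCat.{u} S} (g : A' ⟶ A)
    (a : A ⟶ (restr R S).obj B) :
    (tensorFunctor R S).map g ≫ extendHom a = extendHom (g ≫ a) := by
  apply ModuleCat.hom_ext
  refine TensorProduct.ext' fun s x => ?_
  exact (extendLinear_tmul a s _).trans (extendLinear_tmul (g ≫ a) s x).symm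

theorem extendHom_comp_map {A : ModuleCat.{u} R} {B B' : ModuleCat.{u} S}
    (a : A ⟶ (restr R S).obj B) (b : B ⟶ B') :
    extendHom a ≫ (restr R S).map b = extendHom (a ≫ (restr R S).map b) := by
  apply ModuleCat.hom_ext
  refine TensorProduct.ext' fun s x => ?_
  exact (congrArg b.hom (extendLinear_tmul a s x)).trans
    ((b.hom.map_smul s _).trans (extendLinear_tmul (a ≫ (restr R S).map b) s x).symm)

variable [Module.Flat R S]

theorem mem_torsionCocycles_restr {Z : ModuleCat.{u} S} {I : Ideal R} (Q : InjectiveResolution Z)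
    (i : ℕ) (z : Q.cocomplex.X i) :
    z ∈ torsionCocycles (I.map (algebraMap R S)) Q i ↔
      (show (restrResolution (R := R) Q).cocomplex.X i from z) ∈
        torsionCocycles I (restrResolution (R := R) Q) i := by
  let _ : Module R (Q.cocomplex.X i) := Module.compHom _ (algebraMap R S)
  have : IsScalarTower R S (Q.cocomplex.X i) := isScalarTower_compHom _
  exact and_congr (mem_powTorsion_map_iff (S := S) I z) Iff.rfl

theorem localCohRestr_bijective (I : Ideal R) (i : ℕ) (Z : ModuleCat.{u} S) :
    Function.Bijective (localCohRestr I i Z).hom := by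
  constructor
  · rw [injective_iff_map_eq_zero]
    intro h hh
    obtain ⟨w, rfl⟩ := cocycleClass_surjective I
      (restrResolution (R := R) (injectiveResolution Z)) i h
    rw [localCohRestr_cocycleClass I i Z w
      ⟨w.1, (mem_torsionCocycles_restr _ i _).2 w.2⟩ rfl] at hh
    obtain ⟨j, y, hy, hyz⟩ := (cocycleClass_eq_zero_iff _ _ _ _).1 hh
    let _ : Module R ((injectiveResolution Z).cocomplex.X j) := Module.compHom _ (algebraMap R S)
    have : IsScalarTower R S ((injectiveResolution Z).cocomplex.X j) := isScalarTower_compHom _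
    exact (cocycleClass_eq_zero_iff _ _ _ _).2
      ⟨j, y, (mem_powTorsion_map_iff (S := S) I y).1 hy, hyz⟩
  · intro h
    obtain ⟨z, rfl⟩ := cocycleClass_surjective (I.map (algebraMap R S))
      (injectiveResolution Z) i h
    exact ⟨_, localCohRestr_cocycleClass I i Z
      ⟨z.1, (mem_torsionCocycles_restr _ i _).1 z.2⟩ z rfl⟩

/-- The `S`-linear extension `S ⊗ P → Q` of a map `P → Q` of complexes over `R`, where `P` and
`Q` are resolutions over `R` and over `S`. -/
noncomputable def extendResolutionMap [IsNoetherianRing R] {X : ModuleCat.{u} R}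
    {Z : ModuleCat.{u} S} (P : InjectiveResolution X) (Q : InjectiveResolution Z)
    (α : P.cocomplex ⟶ (restrResolution (R := R) Q).cocomplex) :
    (tensorResolution S P).cocomplex ⟶ (restrResolution (R := R) Q).cocomplex where
  f i := extendHom (α.f i)
  comm' i j _ :=
    (extendHom_comp_map (α.f i) (Q.cocomplex.d i j)).trans
      ((congrArg extendHom (α.comm i j)).trans (map_comp_extendHom _ _).symm)

theorem localCohMap_cocycleClass (f : X →ₗ[R] Y) (I : Ideal R)
    (P : InjectiveResolution (ModuleCat.of R X))
    (α : P.cocomplex ⟶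
      (restrResolution (R := R) (injectiveResolution (ModuleCat.of S Y))).cocomplex)
    (comm : P.ι.f 0 ≫ α.f 0 = toRestr f ≫ (restrResolution (R := R)
      (injectiveResolution (ModuleCat.of S Y))).ι.f 0) (i : ℕ) (z : torsionCocycles I P i)
    (w : torsionCocycles (I.map (algebraMap R S)) (injectiveResolution (ModuleCat.of S Y)) i)
    (h : (α.f i).hom z = w.1) :
    localCohMap I i f (cocycleClass I P i z) =
      cocycleClass (I.map (algebraMap R S)) (injectiveResolution (ModuleCat.of S Y)) i w := by
  refine (congrArg (localCohRestr I i (ModuleCat.of S Y)).hom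
    (rightDerived_map_cocycleClass I (toRestr f) P _ α comm i z
      ⟨w.1, (mem_torsionCocycles_restr _ i _).1 w.2⟩ h)).trans ?_
  exact localCohRestr_cocycleClass _ _ _ _ _ rfl

theorem map_mem_torsionCocycles {I : Ideal R} {X X' : ModuleCat.{u} R}
    {P : InjectiveResolution X} {P' : InjectiveResolution X'} (φ : P.cocomplex ⟶ P'.cocomplex)
    {i : ℕ} {z : P.cocomplex.X i} (hz : z ∈ torsionCocycles I P i) :
    (φ.f i).hom z ∈ torsionCocycles I P' i := by
  refine ⟨map_mem_powTorsion I (φ.f i).hom hz.1, ?_⟩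
  refine (ConcreteCategory.congr_hom (φ.comm i (i + 1)) z).trans ?_
  exact (congrArg (φ.f (i + 1)).hom hz.2).trans (map_zero _)

/-- A torsion cocycle of `S ⊗ P` comes from `S ⊗ Z`, where `Z` is the module of torsion cocycles
of `P`. -/
theorem exists_of_mem_torsionCocycles_tensorResolution [IsNoetherianRing R] {I : Ideal R}
    {X : ModuleCat.{u} R} {P : InjectiveResolution X} {i : ℕ}
    {z : (tensorResolution S P).cocomplex.X i}
    (hz : z ∈ torsionCocycles I (tensorResolution S P) i) :
    ∃ t : S ⊗[R] torsionCocycles I P i, (torsionCocycles I P i).subtype.lTensor S t = z := by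
  obtain ⟨t, ht⟩ := exists_of_mem_powTorsion_tensorProduct I hz.1
  let d : powTorsion I (P.cocomplex.X i) →ₗ[R] P.cocomplex.X (i + 1) :=
    (P.cocomplex.d i (i + 1)).hom ∘ₗ Submodule.subtype _
  let k : torsionCocycles I P i →ₗ[R] powTorsion I (P.cocomplex.X i) :=
    Submodule.inclusion inf_le_left
  have hex : Function.Exact k d := by
    intro x
    constructor
    · intro hx
      exact ⟨⟨x.1, x.2, hx⟩, rfl⟩
    · rintro ⟨y, rfl⟩
      exact y.2.2
  have h0 : d.lTensor S t = 0 := by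
    have : ((P.cocomplex.d i (i + 1)).hom.lTensor S) z = 0 := hz.2
    rw [← ht, ← LinearMap.comp_apply, ← LinearMap.lTensor_comp] at this
    exact this
  obtain ⟨u, rfl⟩ := (Module.Flat.lTensor_exact S hex t).1 h0
  refine ⟨u, ht ▸ ?_⟩
  rw [← LinearMap.comp_apply, ← LinearMap.lTensor_comp]
  rfl

omit [Module.Flat R S] in
theorem isIso_extendHom_toRestr (f : X →ₗ[R] Y) (hf : IsBaseChange S f) :
    IsIso (extendHom (S := S) (toRestr f)) := by
  rw [ConcreteCategory.isIso_iff_bijective]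
  have : ⇑(extendHom (S := S) (toRestr f)).hom = hf.equiv := by
    funext t
    induction t using TensorProduct.induction_on with
    | zero => exact (map_zero (extendHom (toRestr f)).hom).trans (map_zero hf.equiv).symm
    | tmul s x => exact (extendLinear_tmul _ s x).trans (hf.equiv_tmul s x).symm
    | add t u ht hu =>
      exact (map_add (extendHom (toRestr f)).hom t u).trans
        ((congrArg₂ _ ht hu).trans (map_add hf.equiv t u).symm)
  change Function.Bijective (extendHom (S := S) (toRestr f)).hom
  rw [this]
  exact hf.equiv.bijective

variable (S) in
/-- `localCohMap` as a morphism into the restriction of scalars of `H^i_{IS}(Y)`. -/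
noncomputable def localCohMapHom (I : Ideal R) (i : ℕ) (f : X →ₗ[R] Y) :
    localCoh I i X ⟶ (restr R S).obj (localCoh (I.map (algebraMap R S)) i Y) :=
  ((sectionFunctor I).rightDerived i).map (toRestr f) ≫ localCohRestr I i (ModuleCat.of S Y)

/-- The map `S ⊗ H^i_I(X) → H^i_{IS}(Y)` induced by an `R`-linear map `X → Y`. -/
noncomputable def baseChangeLocalCoh (I : Ideal R) (i : ℕ) (f : X →ₗ[R] Y) :
    S ⊗[R] localCoh I i X →ₗ[S] localCoh (I.map (algebraMap R S)) i Y :=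
  extendLinear (localCohMapHom S I i f)

theorem baseChangeLocalCoh_tmul (I : Ideal R) (i : ℕ) (f : X →ₗ[R] Y) (s : S)
    (h : localCoh I i X) :
    baseChangeLocalCoh I i f (s ⊗ₜ h) = s • localCohMap I i f h :=
  extendLinear_tmul (localCohMapHom S I i f) s h

/-- The bijection `H^i_I(S ⊗ X) → H^i_{IS}(Y)` if `Y` is the base change of `X`. -/
noncomputable def localCohExtend (I : Ideal R) (i : ℕ) (f : X →ₗ[R] Y) :
    ((sectionFunctor I).rightDerived i).obj ((tensorFunctor R S).obj (ModuleCat.of R X)) ⟶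
      (restr R S).obj (localCoh (I.map (algebraMap R S)) i Y) :=
  ((sectionFunctor I).rightDerived i).map (extendHom (toRestr f)) ≫
    localCohRestr I i (ModuleCat.of S Y)

theorem localCohExtend_bijective (I : Ideal R) (i : ℕ) (f : X →ₗ[R] Y) (hf : IsBaseChange S f) :
    Function.Bijective (localCohExtend (S := S) I i f).hom := by
  have := isIso_extendHom_toRestr f hf
  have h₁ : Function.Bijective
      (((sectionFunctor I).rightDerived i).map (extendHom (S := S) (toRestr f))).hom :=
    (ConcreteCategory.isIso_iff_bijective _).1
      (Functor.map_isIso ((sectionFunctor I).rightDerived i) _)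
  rw [localCohExtend, ModuleCat.hom_comp, LinearMap.coe_comp]
  exact Function.Bijective.comp (localCohRestr_bijective I i (ModuleCat.of S Y)) h₁

/-- The cocycle of `Q` obtained from `t ∈ S ⊗ Z(P)`, for `Z(P)` the torsion cocycles of `P`,
represents the image of the class of `t` in `S ⊗ H^i_I(X)`. -/
theorem exists_class_extendLinear (I : Ideal R) (i : ℕ) (f : X →ₗ[R] Y)
    (P : InjectiveResolution (ModuleCat.of R X))
    (α : P.cocomplex ⟶
      (restrResolution (R := R) (injectiveResolution (ModuleCat.of S Y))).cocomplex)
    (hα : P.ι.f 0 ≫ α.f 0 = toRestr f ≫ (restrResolution (R := R)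
      (injectiveResolution (ModuleCat.of S Y))).ι.f 0) (t : S ⊗[R] torsionCocycles I P i) :
    ∃ w : torsionCocycles (I.map (algebraMap R S)) (injectiveResolution (ModuleCat.of S Y)) i,
      w.1 = extendLinear (α.f i) ((torsionCocycles I P i).subtype.lTensor S t) ∧
      cocycleClass _ _ i w = baseChangeLocalCoh I i f ((cocycleClass I P i).lTensor S t) := by
  induction t using TensorProduct.induction_on with
  | zero =>
    refine ⟨0, ?_, ?_⟩
    · rw [map_zero, map_zero]; rfl
    · rw [map_zero, map_zero, map_zero]
  | tmul s z =>
    let w : torsionCocycles (I.map (algebraMap R S)) (injectiveResolution (ModuleCat.of S Y)) i :=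
      ⟨(α.f i).hom z.1, (mem_torsionCocycles_restr _ i _).2 (map_mem_torsionCocycles α z.2)⟩
    refine ⟨s • w, (extendLinear_tmul (α.f i) s z.1).symm, ?_⟩
    rw [map_smul]
    refine Eq.trans ?_ (baseChangeLocalCoh_tmul I i f s (cocycleClass I P i z)).symm
    exact congrArg (s • ·) (localCohMap_cocycleClass f I P α hα i z w rfl).symm
  | add t u ht hu =>
    obtain ⟨w₁, h₁, h₁'⟩ := ht
    obtain ⟨w₂, h₂, h₂'⟩ := hu
    refine ⟨w₁ + w₂, ?_, ?_⟩
    · rw [map_add, map_add, ← h₁, ← h₂]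
      rfl
    · rw [map_add, map_add, map_add, h₁', h₂']

/-- On cocycles, `H^i_I(S ⊗ X) → H^i_{IS}(Y)` is the `S`-linear extension of
`H^i_I(X) → H^i_{IS}(Y)`. -/
theorem localCohExtend_cocycleClass [IsNoetherianRing R] (I : Ideal R) (i : ℕ) (f : X →ₗ[R] Y)
    (P : InjectiveResolution (ModuleCat.of R X)) (t : S ⊗[R] torsionCocycles I P i)
    (z : torsionCocycles I (tensorResolution S P) i)
    (h : (torsionCocycles I P i).subtype.lTensor S t = z.1) :
    (localCohExtend I i f).hom (cocycleClass I _ i z) =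
      baseChangeLocalCoh I i f ((cocycleClass I P i).lTensor S t) := by
  let Q := injectiveResolution (ModuleCat.of S Y)
  let α : P.cocomplex ⟶ (restrResolution (R := R) Q).cocomplex :=
    InjectiveResolution.desc (toRestr f) (restrResolution Q) P
  have hα : P.ι.f 0 ≫ α.f 0 = toRestr f ≫ (restrResolution (R := R) Q).ι.f 0 :=
    InjectiveResolution.desc_commutes_zero _ _ _
  have hβ : (tensorResolution S P).ι.f 0 ≫ (extendResolutionMap P Q α).f 0 =
      extendHom (toRestr f) ≫ (restrResolution (R := R) Q).ι.f 0 := by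
    rw [tensorResolution_ι, restrResolution_ι] at *
    exact (map_comp_extendHom _ _).trans ((congrArg extendHom hα).trans
      (extendHom_comp_map _ _).symm)
  obtain ⟨w, hw₁, hw₂⟩ := exists_class_extendLinear I i f P α hα t
  rw [← hw₂]
  refine (congrArg (localCohRestr I i (ModuleCat.of S Y)).hom
    (rightDerived_map_cocycleClass I (extendHom (toRestr f)) _ _ _ hβ i z
      ⟨w.1, (mem_torsionCocycles_restr _ i _).1 w.2⟩ ?_)).trans
        (localCohRestr_cocycleClass _ _ _ _ _ rfl)
  exact (congrArg (extendLinear (α.f i)) h.symm).trans hw₁.symm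

theorem lTensor_subtype_mem_torsionCocycles [IsNoetherianRing R] {I : Ideal R}
    {X : ModuleCat.{u} R} (P : InjectiveResolution X) {i : ℕ}
    (t : S ⊗[R] torsionCocycles I P i) :
    (torsionCocycles I P i).subtype.lTensor S t ∈ torsionCocycles I (tensorResolution S P) i := by
  induction t using TensorProduct.induction_on with
  | zero => rw [map_zero]; exact zero_mem _
  | tmul s z =>
    refine ⟨map_mem_powTorsion I (TensorProduct.mk R S (P.cocomplex.X i) s) z.2.1, ?_⟩
    exact (congrArg (fun x => s ⊗ₜ[R] x) z.2.2).trans (TensorProduct.tmul_zero _ s)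
  | add t u ht hu => rw [map_add]; exact add_mem ht hu

/-- Flat base change for local cohomology: if `Y = S ⊗ X`, then
`S ⊗ H^i_I(X) ≅ H^i_{IS}(Y)`. -/
theorem baseChangeLocalCoh_bijective [IsNoetherianRing R] (I : Ideal R) (i : ℕ)
    (f : X →ₗ[R] Y) (hf : IsBaseChange S f) :
    Function.Bijective (baseChangeLocalCoh (S := S) I i f) := by
  let P := injectiveResolution (ModuleCat.of R X)
  have he := localCohExtend_bijective I i f hf
  constructor
  · rw [injective_iff_map_eq_zero]
    intro u hu
    obtain ⟨t, rfl⟩ := LinearMap.lTensor_surjective S (cocycleClass_surjective I P i) u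
    rw [← localCohExtend_cocycleClass I i f P t ⟨_, lTensor_subtype_mem_torsionCocycles P t⟩
      rfl] at hu
    have h0 := he.1 (hu.trans (map_zero _).symm)
    obtain ⟨j, y, hy, hyz⟩ := (cocycleClass_eq_zero_iff _ _ _ _).1 h0
    obtain ⟨v, rfl⟩ := exists_of_mem_powTorsion_tensorProduct I hy
    -- the boundary is one of `S ⊗ Γ_I(P)`
    let d : powTorsion I (P.cocomplex.X j) →ₗ[R] torsionCocycles I P i :=
      { toFun := fun y => ⟨(P.cocomplex.d j i).hom y.1,
          map_mem_powTorsion I _ y.2,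
          ConcreteCategory.congr_hom (P.cocomplex.d_comp_d j i (i + 1)) y.1⟩
        map_add' := fun y y' => Subtype.ext (map_add _ _ _)
        map_smul' := fun r y => Subtype.ext (map_smul _ _ _) }
    have ht : d.lTensor S v = t := by
      apply Module.Flat.lTensor_preserves_injective_linearMap (M := S) _
        (torsionCocycles I P i).subtype_injective
      refine Eq.trans ?_ hyz
      change _ = ((P.cocomplex.d j i).hom.lTensor S) _
      rw [← LinearMap.comp_apply, ← LinearMap.lTensor_comp, ← LinearMap.comp_apply,
        ← LinearMap.lTensor_comp]
      rfl
    have hd : (cocycleClass I P i) ∘ₗ d = 0 :=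
      LinearMap.ext fun y => (cocycleClass_eq_zero_iff _ _ _ _).2 ⟨j, y.1, y.2, rfl⟩
    rw [← ht, ← LinearMap.comp_apply, ← LinearMap.lTensor_comp, hd, LinearMap.lTensor_zero]
    rfl
  · intro h
    obtain ⟨h', rfl⟩ := he.2 h
    obtain ⟨z, rfl⟩ := cocycleClass_surjective I (tensorResolution S P) i h'
    obtain ⟨t, ht⟩ := exists_of_mem_torsionCocycles_tensorResolution z.2
    exact ⟨_, (localCohExtend_cocycleClass I i f P t z ht).symm⟩

end BaseChange

/-! ### Vanishing of Ext below the grade -/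

section ExtVanishing

variable {R : Type u} [CommRing R] {X : ModuleCat.{u} R}

/-- `Ext^i(N, X) = 0`, expressed through an injective resolution `P` of `X`: every cocycle
`N → P^i` lifts to `P^{i-1}`. (For `i = 0` the differential `P^{0-1} → P^0` is zero.) -/
def CocyclesLift (P : InjectiveResolution X) (N : Type u) [AddCommGroup N] [Module R N] (i : ℕ) :
    Prop :=
  ∀ φ : N →ₗ[R] P.cocomplex.X i, (P.cocomplex.d i (i + 1)).hom ∘ₗ φ = 0 →
    ∃ ψ : N →ₗ[R] P.cocomplex.X (i - 1), (P.cocomplex.d (i - 1) i).hom ∘ₗ ψ = φ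

theorem injective_resolution (P : InjectiveResolution X) (i : ℕ) :
    Module.Injective R (P.cocomplex.X i) :=
  Module.injective_module_of_injective_object R (P.cocomplex.X i) (inj := P.injective i)

theorem d_zero_zero (P : InjectiveResolution X) (y : P.cocomplex.X 0) :
    (P.cocomplex.d 0 0).hom y = 0 := by
  rw [P.cocomplex.shape 0 0 (by simp)]
  rfl

theorem d_d (P : InjectiveResolution X) (i j k : ℕ) (y : P.cocomplex.X i) :
    (P.cocomplex.d j k).hom ((P.cocomplex.d i j).hom y) = 0 :=
  ConcreteCategory.congr_hom (P.cocomplex.d_comp_d i j k) y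

theorem cocyclesLift_of_subsingleton_ext (P : InjectiveResolution X) (N : Type u) [AddCommGroup N]
    [Module R N] (i : ℕ) (h : Subsingleton (Abelian.Ext (ModuleCat.of R N) X i)) :
    CocyclesLift P N i := by
  intro φ hφ
  have hφ' : ModuleCat.ofHom φ ≫ P.cocomplex.d i (i + 1) = 0 := ModuleCat.hom_ext hφ
  cases i with
  | zero =>
    have h0 := P.exact₀.lift_f (ModuleCat.ofHom φ) hφ'
    have h' : Subsingleton (ModuleCat.of R N ⟶ X) := Abelian.Ext.homEquiv₀.symm.subsingleton
    have : P.exact₀.lift (ModuleCat.ofHom φ) hφ' = 0 := @Subsingleton.elim _ h' _ _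
    rw [this, Limits.zero_comp] at h0
    refine ⟨0, ?_⟩
    rw [LinearMap.comp_zero]
    exact congrArg ModuleCat.Hom.hom h0
  | succ k =>
    obtain ⟨g, hg⟩ := (P.extMk_eq_zero_iff (ModuleCat.ofHom φ) (k + 2) rfl hφ' k rfl).1
      (Subsingleton.elim _ _)
    exact ⟨g.hom, congrArg ModuleCat.Hom.hom hg⟩

variable {P : InjectiveResolution X}

/-- Modifying `ψ : F → P^i` by a coboundary makes it factor through `p : F → N`, provided that
`d ψ` does and that cocycles on `ker p` lift. -/
theorem CocyclesLift.exists_descend {F N : Type u} [AddCommGroup F] [Module R F] [AddCommGroup N]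
    [Module R N] (p : F →ₗ[R] N) {i : ℕ} (hK : CocyclesLift P (LinearMap.ker p) i)
    (ψ : F →ₗ[R] P.cocomplex.X i)
    (hψ : ∀ x ∈ LinearMap.ker p, (P.cocomplex.d i (i + 1)).hom (ψ x) = 0) :
    ∃ θ : N →ₗ[R] P.cocomplex.X i, ∀ x,
      (P.cocomplex.d i (i + 1)).hom (θ (p x)) = (P.cocomplex.d i (i + 1)).hom (ψ x) := by
  obtain ⟨χ, hχ⟩ := hK (ψ ∘ₗ (LinearMap.ker p).subtype) (LinearMap.ext fun x => hψ x.1 x.2)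
  obtain ⟨χ', hχ'⟩ := (injective_resolution P (i - 1)).out (LinearMap.ker p).subtype
    (LinearMap.ker p).subtype_injective χ
  let ψ' := ψ - (P.cocomplex.d (i - 1) i).hom ∘ₗ χ'
  have hψ' : LinearMap.ker p ≤ LinearMap.ker ψ' := by
    intro x hx
    have h := LinearMap.congr_fun hχ ⟨x, hx⟩
    have h' := hχ' ⟨x, hx⟩
    change ψ x - (P.cocomplex.d (i - 1) i).hom (χ' x) = 0
    rw [sub_eq_zero]
    refine h.symm.trans (congrArg (P.cocomplex.d (i - 1) i).hom h'.symm)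
  obtain ⟨θ, hθ⟩ := (injective_resolution P i).out ((LinearMap.ker p).liftQ p le_rfl)
    (LinearMap.ker_eq_bot.1 (Submodule.ker_liftQ_eq_bot _ _ _ le_rfl))
    ((LinearMap.ker p).liftQ ψ' hψ')
  refine ⟨θ, fun x => ?_⟩
  have h : θ (p x) = ψ x - (P.cocomplex.d (i - 1) i).hom (χ' x) :=
    hθ (Submodule.Quotient.mk x)
  rw [h, map_sub, d_d, sub_zero]

theorem CocyclesLift.pi {N : Type u} [AddCommGroup N] [Module R N] {i : ℕ}
    (hN : CocyclesLift P N i) (k : ℕ) : CocyclesLift P (Fin k → N) i := by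
  intro φ hφ
  have h (a : Fin k) := hN (φ ∘ₗ LinearMap.single R (fun _ => N) a) (by
    rw [← LinearMap.comp_assoc, hφ, LinearMap.zero_comp])
  choose ψ hψ using h
  refine ⟨LinearMap.lsum R (fun _ => N) R ψ, LinearMap.pi_ext' fun a => ?_⟩
  rw [← hψ a, LinearMap.comp_assoc]
  congr 1
  ext x
  exact LinearMap.lsum_piSingle ..

/-- Dimension shifting along `0 → ker p → F → N → 0`. -/
theorem CocyclesLift.of_surjective {F N : Type u} [AddCommGroup F] [Module R F] [AddCommGroup N]
    [Module R N] (p : F →ₗ[R] N) (hp : Function.Surjective p) {i : ℕ} (hF : CocyclesLift P F i)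
    (hK : ∀ j < i, CocyclesLift P (LinearMap.ker p) j) : CocyclesLift P N i := by
  intro φ hφ
  obtain ⟨ψ, hψ⟩ := hF (φ ∘ₗ p) (by rw [← LinearMap.comp_assoc, hφ, LinearMap.zero_comp])
  cases i with
  | zero =>
    refine ⟨0, LinearMap.ext fun x => ?_⟩
    obtain ⟨x, rfl⟩ := hp x
    refine Eq.trans ?_ (LinearMap.congr_fun hψ x)
    exact (map_zero (P.cocomplex.d (0 - 1) 0).hom).trans (d_zero_zero P _).symm
  | succ i =>
    obtain ⟨θ, hθ⟩ := (hK i i.lt_succ_self).exists_descend p ψ (fun x hx => by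
      refine (LinearMap.congr_fun hψ x).trans ?_
      rw [LinearMap.comp_apply, LinearMap.mem_ker.1 hx, map_zero])
    refine ⟨θ, LinearMap.ext fun x => ?_⟩
    obtain ⟨x, rfl⟩ := hp x
    exact (hθ x).trans (LinearMap.congr_fun hψ x)

theorem CocyclesLift.extension {N : Type u} [AddCommGroup N] [Module R N] (A : Submodule R N)
    {i : ℕ} (hA : CocyclesLift P A i) (hB : CocyclesLift P (N ⧸ A) i) : CocyclesLift P N i := by
  intro φ hφ
  obtain ⟨ψ, hψ⟩ := hA (φ ∘ₗ A.subtype) (by rw [← LinearMap.comp_assoc, hφ, LinearMap.zero_comp])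
  obtain ⟨ψ₁, hψ₁⟩ := (injective_resolution P (i - 1)).out A.subtype A.subtype_injective ψ
  let φ' := φ - (P.cocomplex.d (i - 1) i).hom ∘ₗ ψ₁
  have hφ' : A ≤ LinearMap.ker φ' := by
    intro x hx
    change φ x - (P.cocomplex.d (i - 1) i).hom (ψ₁ x) = 0
    rw [sub_eq_zero]
    exact (LinearMap.congr_fun hψ ⟨x, hx⟩).symm.trans
      (congrArg (P.cocomplex.d (i - 1) i).hom (hψ₁ ⟨x, hx⟩).symm)
  obtain ⟨θ, hθ⟩ := hB (A.liftQ φ' hφ') (by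
    ext x
    change (P.cocomplex.d i (i + 1)).hom (φ x - (P.cocomplex.d (i - 1) i).hom (ψ₁ x)) = 0
    rw [map_sub, d_d, sub_zero]
    exact LinearMap.congr_fun hφ x)
  refine ⟨ψ₁ + θ ∘ₗ A.mkQ, LinearMap.ext fun x => ?_⟩
  have h : (P.cocomplex.d (i - 1) i).hom (θ (A.mkQ x)) =
    φ x - (P.cocomplex.d (i - 1) i).hom (ψ₁ x) := LinearMap.congr_fun hθ (A.mkQ x)
  change (P.cocomplex.d (i - 1) i).hom (ψ₁ x + θ (A.mkQ x)) = _
  rw [map_add, h, add_sub_cancel]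

/-- A finite module killed by `I` is a quotient of a power of `R / I`. -/
theorem exists_surjective_pi_quotient (I : Ideal R) (N : Type u) [AddCommGroup N] [Module R N]
    [Module.Finite R N] (hN : ∀ a ∈ I, ∀ x : N, a • x = 0) :
    ∃ (k : ℕ) (p : (Fin k → R ⧸ I) →ₗ[R] N), Function.Surjective p := by
  obtain ⟨k, f, hf⟩ := Module.Finite.exists_fin' R N
  let q : Fin k → R ⧸ I →ₗ[R] N := fun a =>
    I.liftQ (f ∘ₗ LinearMap.single R (fun _ => R) a) fun r hr => by
      have : f (Pi.single a (r • 1)) = 0 := by rw [Pi.single_smul, map_smul, hN r hr]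
      simpa using this
  refine ⟨k, LinearMap.lsum R (fun _ => R ⧸ I) R q, fun x => ?_⟩
  obtain ⟨y, rfl⟩ := hf x
  refine ⟨fun a => Ideal.Quotient.mk I (y a), ?_⟩
  rw [LinearMap.lsum_apply, LinearMap.sum_apply]
  conv_rhs => rw [← LinearMap.sum_single_apply (φ := fun _ => R) y, map_sum]
  rfl

variable [IsNoetherianRing R]

theorem cocyclesLift_of_smul_eq_zero (I : Ideal R) (g : ℕ)
    (h : ∀ i < g, CocyclesLift P (R ⧸ I) i) (i : ℕ) (hi : i < g) (N : Type u) [AddCommGroup N]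
    [Module R N] [Module.Finite R N] (hN : ∀ a ∈ I, ∀ x : N, a • x = 0) : CocyclesLift P N i := by
  induction i using Nat.strong_induction_on generalizing N with
  | _ i ih =>
    obtain ⟨k, p, hp⟩ := exists_surjective_pi_quotient I N hN
    refine ((h i hi).pi k).of_surjective p hp fun j hj => ?_
    refine ih j hj (hj.trans hi) _ fun a ha x => Subtype.ext (funext fun b => ?_)
    obtain ⟨r, hr⟩ := Ideal.Quotient.mk_surjective (x.1 b)
    change a • x.1 b = 0
    rw [← hr, ← Ideal.Quotient.mk_eq_mk, ← Submodule.Quotient.mk_smul,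
      Submodule.Quotient.mk_eq_zero]
    exact I.mul_mem_right r ha

/-- If `Ext^i(R/I, X) = 0` for all `i < g`, then `Ext^i(N, X) = 0` for all `i < g` and all finite
modules `N` killed by a power of `I`. -/
theorem cocyclesLift_of_pow_smul_eq_zero (I : Ideal R) (g : ℕ)
    (h : ∀ i < g, CocyclesLift P (R ⧸ I) i) (i : ℕ) (hi : i < g) (n : ℕ) (N : Type u)
    [AddCommGroup N] [Module R N] [Module.Finite R N] (hN : ∀ a ∈ I ^ n, ∀ x : N, a • x = 0) :
    CocyclesLift P N i := by
  induction n generalizing N with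
  | zero =>
    intro φ _
    refine ⟨0, LinearMap.ext fun x => ?_⟩
    have : x = 0 := by simpa using hN 1 (by simp) x
    rw [this, map_zero, map_zero]
  | succ n ih =>
    refine CocyclesLift.extension (I • (⊤ : Submodule R N)) (ih _ fun a ha x => ?_) ?_
    · apply Subtype.ext
      change a • x.1 = 0
      refine Submodule.smul_induction_on x.2 (fun b hb y _ => ?_) fun y z hy hz => ?_
      · rw [smul_smul]
        exact hN _ (by rw [pow_succ]; exact Ideal.mul_mem_mul ha hb) y
      · rw [smul_add, hy, hz, add_zero]
    · refine cocyclesLift_of_smul_eq_zero I g h i hi _ fun a ha x => ?_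
      obtain ⟨x, rfl⟩ := Submodule.Quotient.mk_surjective _ x
      rw [← Submodule.Quotient.mk_smul, Submodule.Quotient.mk_eq_zero]
      exact Submodule.smul_mem_smul ha trivial

end ExtVanishing

/-! ### Finiteness of the annihilated submodules of local cohomology -/

section Finiteness

variable {R : Type u} [CommRing R] {X : ModuleCat.{u} R}

/-- The cocycles of degree `i` killed by `J`: the cocycles of `Hom(R / J, P)`. -/
noncomputable def annCocycles (J : Ideal R) (P : InjectiveResolution X) (i : ℕ) :
    Submodule R (P.cocomplex.X i) where
  carrier := {z | (P.cocomplex.d i (i + 1)).hom z = 0 ∧ ∀ a ∈ J, a • z = 0}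
  zero_mem' := ⟨map_zero _, fun _ _ => smul_zero _⟩
  add_mem' := fun {y z} hy hz => ⟨by rw [map_add, hy.1, hz.1, add_zero], fun a ha => by
    rw [smul_add, hy.2 a ha, hz.2 a ha, add_zero]⟩
  smul_mem' := fun r z hz => ⟨by rw [map_smul, hz.1, smul_zero], fun a ha => by
    rw [smul_comm, hz.2 a ha, smul_zero]⟩

/-- The map `R / J → Y` that sends `1` to a given element killed by `J`. -/
noncomputable def ofAnn (J : Ideal R) {Y : Type u} [AddCommGroup Y] [Module R Y] (y : Y)
    (hy : ∀ a ∈ J, a • y = 0) : R ⧸ J →ₗ[R] Y :=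
  J.liftQ (LinearMap.toSpanSingleton R Y y) hy

theorem ofAnn_mk (J : Ideal R) {Y : Type u} [AddCommGroup Y] [Module R Y] (y : Y)
    (hy : ∀ a ∈ J, a • y = 0) (r : R) : ofAnn J y hy (Ideal.Quotient.mk J r) = r • y := rfl

theorem ofAnn_add (J : Ideal R) {Y : Type u} [AddCommGroup Y] [Module R Y] (y z : Y)
    (hy : ∀ a ∈ J, a • y = 0) (hz : ∀ a ∈ J, a • z = 0) (hyz : ∀ a ∈ J, a • (y + z) = 0) :
    ofAnn J (y + z) hyz = ofAnn J y hy + ofAnn J z hz :=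
  LinearMap.ext fun r => by
    obtain ⟨r, rfl⟩ := Ideal.Quotient.mk_surjective r
    exact smul_add r y z

theorem ofAnn_smul (J : Ideal R) {Y : Type u} [AddCommGroup Y] [Module R Y] (t : R) (y : Y)
    (hy : ∀ a ∈ J, a • y = 0) (hty : ∀ a ∈ J, a • t • y = 0) :
    ofAnn J (t • y) hty = t • ofAnn J y hy :=
  LinearMap.ext fun r => by
    obtain ⟨r, rfl⟩ := Ideal.Quotient.mk_surjective r
    exact smul_comm r t y

theorem ofAnn_comp_d (J : Ideal R) (P : InjectiveResolution X) (i : ℕ) (z : annCocycles J P i) :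
    ModuleCat.ofHom (ofAnn J z.1 z.2.2) ≫ P.cocomplex.d i (i + 1) = 0 := by
  ext
  exact (congrArg (P.cocomplex.d i (i + 1)).hom (one_smul R z.1)).trans z.2.1

/-- A cocycle killed by `J` is a cocycle `R / J → P^i`; this is its class in `Ext^i(R / J, X)`. -/
noncomputable def annCocycleClass (J : Ideal R) (P : InjectiveResolution X) (i : ℕ) :
    annCocycles J P i →ₗ[R] Abelian.Ext (ModuleCat.of R (R ⧸ J)) X i where
  toFun z := P.extMk (ModuleCat.ofHom (ofAnn J z.1 z.2.2)) (i + 1) rfl (ofAnn_comp_d J P i z)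
  map_add' y z := by
    rw [P.add_extMk]
    congr 1
    exact congrArg ModuleCat.ofHom (ofAnn_add J y.1 z.1 y.2.2 z.2.2 (y + z).2.2)
  map_smul' r z := by
    have h := P.mk₀_comp_extMk (ModuleCat.ofHom (ofAnn J z.1 z.2.2)) (i + 1) rfl
      (ofAnn_comp_d J P i z) (r • 𝟙 (ModuleCat.of R (R ⧸ J)))
    rw [Abelian.Ext.mk₀_smul, Abelian.Ext.smul_comp, Abelian.Ext.mk₀_id_comp] at h
    rw [RingHom.id_apply, h]
    congr 1
    rw [Linear.smul_comp, Category.id_comp]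
    exact congrArg ModuleCat.ofHom (ofAnn_smul J r z.1 z.2.2 (r • z).2.2)

variable [IsNoetherianRing R]

/-- `Ext^i(R/J, X)` is finite if `X` is: modulo some of the coboundaries of elements killed
by `J`, the cocycles killed by `J` embed in a Noetherian module. (In degree `0` the index `i - 1`
is `0` and the differential is zero, so that `e` itself is injective.) -/
theorem exists_annCocycles_linearMap [Module.Finite R X] (J : Ideal R) (P : InjectiveResolution X)
    (i : ℕ) : ∃ (B : Type u) (_ : AddCommGroup B) (_ : Module R B) (e : annCocycles J P i →ₗ[R] B),
      IsNoetherian R B ∧ ∀ z, e z = 0 → ∃ y : P.cocomplex.X (i - 1),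
        (∀ a ∈ J, a • y = 0) ∧ (P.cocomplex.d (i - 1) i).hom y = z := by
  cases i with
  | zero =>
    refine ⟨_, inferInstance, inferInstance, LinearMap.id, ?_, fun z hz => ⟨0, ?_, ?_⟩⟩
    · -- a degree-zero cocycle is an element of `X`
      have hX : Module.Finite R (((CochainComplex.single₀ (ModuleCat R)).obj X).X 0) :=
        ‹Module.Finite R X›
      have : IsNoetherian R (LinearMap.range (P.ι.f 0).hom) :=
        isNoetherian_of_surjective _ (LinearMap.range_rangeRestrict (P.ι.f 0).hom)
      refine isNoetherian_of_le (s := annCocycles J P 0) (t := LinearMap.range (P.ι.f 0).hom) ?_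
      intro z hz
      exact (ShortComplex.moduleCat_exact_iff _).1 P.exact₀ z hz.1
    · simp
    · rw [map_zero, (show z = 0 from hz)]; rfl
  | succ k =>
    refine ⟨_, inferInstance, inferInstance, annCocycleClass J P (k + 1), ?_, fun z hz => ?_⟩
    · have : Module.Finite R (Abelian.Ext (ModuleCat.of R (R ⧸ J)) X (k + 1)) :=
        ModuleCat.finite_ext R (ModuleCat.of R (R ⧸ J)) X (k + 1)
      exact isNoetherian_of_isNoetherianRing_of_finite R _
    · obtain ⟨g, hg⟩ := (P.extMk_eq_zero_iff _ _ rfl (ofAnn_comp_d J P (k + 1) z) k rfl).1 hz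
      refine ⟨g.hom (Ideal.Quotient.mk J 1), fun a ha => ?_, ?_⟩
      · rw [← map_smul, ← Ideal.Quotient.mk_eq_mk, ← Submodule.Quotient.mk_smul,
          (Submodule.Quotient.mk_eq_zero _).2 (by simpa using ha), map_zero]
      · refine (ConcreteCategory.congr_hom hg (Ideal.Quotient.mk J 1)).trans ?_
        exact one_smul R z.1

/-- If `Ext^i(R/I, X) = 0` for `i < g`, then a class in `H^g_I(X)` killed by `I^n` is represented
by a cocycle killed by `I^n`. Let `z` be any representative, `a₁, …, a_m` generators of `I^n`, and
`a_b z = d y_b`. For large `q`, the `y_b` define a map `ψ : (R/I^q)^m → P^{g-1}`, and `d ψ` factors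
through `ρ = (a₁, …, a_m) : (R/I^q)^m → R/I^q`. As `Ext^{g-1}(ker ρ, X) = 0`, the map `ψ` can be
changed by a coboundary so as to factor through `ρ` too, say as `θ ∘ ρ`; then `z - d θ(1)` is the
representative sought. -/
theorem exists_annCocycles_class_eq (I : Ideal R) (P : InjectiveResolution X) (g : ℕ)
    (hg : ∀ i < g, CocyclesLift P (R ⧸ I) i) (n : ℕ)
    (h : ((sectionFunctor I).rightDerived g).obj X) (hh : ∀ a ∈ I ^ n, a • h = 0) :
    ∃ z : torsionCocycles I P g, z.1 ∈ annCocycles (I ^ n) P g ∧ cocycleClass I P g z = h := by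
  obtain ⟨z, rfl⟩ := cocycleClass_surjective I P g h
  have hz (a : R) (ha : a ∈ I ^ n) := (cocycleClass_eq_zero_iff I P g (a • z)).1
    (by rw [map_smul, hh a ha])
  cases g with
  | zero =>
    refine ⟨z, ⟨z.2.2, fun a ha => ?_⟩, rfl⟩
    obtain ⟨j, y, -, hy⟩ := hz a ha
    refine Eq.trans hy.symm ?_
    rw [P.cocomplex.shape j 0 (by simp)]
    rfl
  | succ k =>
    have hz' (a : R) (ha : a ∈ I ^ n) : ∃ y ∈ powTorsion I (P.cocomplex.X k),
        (P.cocomplex.d k (k + 1)).hom y = a • z.1 := by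
      obtain ⟨j, y, hy, hyz⟩ := hz a ha
      by_cases hj : j = k
      · subst hj
        exact ⟨y, hy, hyz⟩
      · refine ⟨0, zero_mem _, ?_⟩
        rw [map_zero]
        refine Eq.trans ?_ hyz
        rw [P.cocomplex.shape j (k + 1) (by simpa using hj)]
        rfl
    obtain ⟨m, a, ha⟩ := Submodule.fg_iff_exists_fin_generating_family.1
      (IsNoetherian.noetherian (I ^ n))
    have ha' (b : Fin m) : a b ∈ I ^ n := ha ▸ Submodule.subset_span ⟨b, rfl⟩
    choose y hy hyz using fun b => hz' (a b) (ha' b)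
    choose N hN using hy
    obtain ⟨N₀, hN₀⟩ := z.2.1
    -- a power of `I` that kills `z` and all the `y b`
    let q := N₀ + ∑ b, N b
    have hq (b : Fin m) (r : R) (hr : r ∈ I ^ q) : r • y b = 0 :=
      hN b r (Ideal.pow_le_pow_right ((Finset.single_le_sum (f := N) (fun _ _ => Nat.zero_le _)
        (Finset.mem_univ b)).trans (Nat.le_add_left _ _)) hr)
    have hq₀ (r : R) (hr : r ∈ I ^ q) : r • z.1 = 0 :=
      hN₀ r (Ideal.pow_le_pow_right (Nat.le_add_right _ _) hr)
    let ψ : (Fin m → R ⧸ I ^ q) →ₗ[R] P.cocomplex.X k :=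
      LinearMap.lsum R (fun _ => R ⧸ I ^ q) R fun b => ofAnn (I ^ q) (y b) (hq b)
    let ρ : (Fin m → R ⧸ I ^ q) →ₗ[R] R ⧸ I ^ q :=
      LinearMap.lsum R (fun _ => R ⧸ I ^ q) R fun b => a b • LinearMap.id
    have hψρ : (P.cocomplex.d k (k + 1)).hom ∘ₗ ψ = ofAnn (I ^ q) z.1 hq₀ ∘ₗ ρ := by
      refine LinearMap.pi_ext' fun b => ?_
      ext
      have h₁ : ψ (Pi.single b (Ideal.Quotient.mk _ 1)) = y b :=
        (LinearMap.lsum_piSingle ..).trans (one_smul R (y b))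
      have h₂ : ρ (Pi.single b (Ideal.Quotient.mk _ 1)) = Ideal.Quotient.mk (I ^ q) (a b) :=
        (LinearMap.lsum_piSingle ..).trans
          (congrArg (Ideal.Quotient.mk (I ^ q)) (mul_one (a b)))
      refine (congrArg (P.cocomplex.d k (k + 1)).hom h₁).trans ((hyz b).trans ?_)
      exact (congrArg (ofAnn (I ^ q) z.1 hq₀) h₂).symm
    have hker : CocyclesLift P (LinearMap.ker ρ) k := by
      refine cocyclesLift_of_pow_smul_eq_zero I (k + 1) hg k k.lt_succ_self q _ fun r hr x => ?_
      refine Subtype.ext (funext fun b => ?_)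
      obtain ⟨s, hs⟩ := Ideal.Quotient.mk_surjective (x.1 b)
      change r • x.1 b = 0
      rw [← hs, ← Ideal.Quotient.mk_eq_mk, ← Submodule.Quotient.mk_smul,
        Submodule.Quotient.mk_eq_zero]
      exact Ideal.mul_mem_right s _ hr
    obtain ⟨θ, hθ⟩ := hker.exists_descend ρ ψ fun x hx => by
      refine (LinearMap.congr_fun hψρ x).trans ?_
      rw [LinearMap.comp_apply, LinearMap.mem_ker.1 hx, map_zero]
    have hθ' : ∀ x, (P.cocomplex.d k (k + 1)).hom (θ (ρ x)) = ofAnn (I ^ q) z.1 hq₀ (ρ x) :=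
      fun x => (hθ x).trans (LinearMap.congr_fun hψρ x)
    let w : P.cocomplex.X k := θ (Ideal.Quotient.mk _ 1)
    have hw : w ∈ powTorsion I (P.cocomplex.X k) := by
      refine ⟨q, fun r hr => ?_⟩
      rw [← map_smul, ← Ideal.Quotient.mk_eq_mk, ← Submodule.Quotient.mk_smul,
        (Submodule.Quotient.mk_eq_zero _).2 (by simpa using hr), map_zero]
    have hdw : ∀ r ∈ I ^ n, r • (P.cocomplex.d k (k + 1)).hom w = r • z.1 := by
      intro r hr
      rw [← ha] at hr
      induction hr using Submodule.span_induction with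
      | mem r hr =>
        obtain ⟨b, rfl⟩ := hr
        have h₂ : ρ (Pi.single b (Ideal.Quotient.mk _ 1)) = Ideal.Quotient.mk (I ^ q) (a b) :=
          (LinearMap.lsum_piSingle ..).trans
            (congrArg (Ideal.Quotient.mk (I ^ q)) (mul_one (a b)))
        have h₃ := hθ' (Pi.single b (Ideal.Quotient.mk _ 1))
        rw [h₂] at h₃
        refine Eq.trans ?_ h₃
        rw [← map_smul, ← map_smul]
        refine congrArg (fun x => (P.cocomplex.d k (k + 1)).hom (θ x)) ?_
        exact congrArg (Ideal.Quotient.mk (I ^ q)) (mul_one (a b))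
      | zero => rw [zero_smul, zero_smul]
      | add r s _ _ hr hs => rw [add_smul, add_smul, hr, hs]
      | smul t r _ hr => rw [smul_assoc, smul_assoc, hr]
    let v : torsionCocycles I P (k + 1) :=
      ⟨(P.cocomplex.d k (k + 1)).hom w, map_mem_powTorsion I _ hw, d_d P k (k + 1) (k + 2) w⟩
    refine ⟨z - v, ⟨(z - v).2.2, fun r hr => ?_⟩, ?_⟩
    · change r • (z.1 - (P.cocomplex.d k (k + 1)).hom w) = 0
      rw [smul_sub, hdw r hr, sub_self]
    · rw [map_sub, (cocycleClass_eq_zero_iff I P (k + 1) v).2 ⟨k, w, hw, rfl⟩, sub_zero]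

/-- If `Ext^i(R/I, M) = 0` for `i < g`, then the submodule of `H^g_I(M)` killed by `I^n` is finite:
it is a quotient of `Ext^g(R/I^n, M)`. -/
theorem fg_annihilated_localCoh (I : Ideal R) (M : Type u) [AddCommGroup M] [Module R M]
    [Module.Finite R M] (g : ℕ) (hg : (g : ℕ∞) ≤ idealGrade I M) (n : ℕ) :
    ∃ N : Submodule R (localCoh I g M), N.FG ∧ ∀ h, (∀ a ∈ I ^ n, a • h = 0) → h ∈ N := by
  let P := injectiveResolution (ModuleCat.of R M)
  have hlift : ∀ i < g, CocyclesLift P (R ⧸ I) i := by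
    intro i hi
    refine cocyclesLift_of_subsingleton_ext P _ i ?_
    by_contra hne
    rw [not_subsingleton_iff_nontrivial] at hne
    have : idealGrade I M ≤ (i : ℕ∞) := iInf_le
      (fun i : {i : ℕ // Nontrivial (Abelian.Ext (ModuleCat.of R (R ⧸ I)) (ModuleCat.of R M) i)} =>
        ((i : ℕ) : ℕ∞)) ⟨i, hne⟩
    exact absurd (hg.trans this) (by simpa using hi)
  have : Module.Finite R (ModuleCat.of R M) := ‹Module.Finite R M›
  obtain ⟨B, _, _, e, hB, he⟩ := exists_annCocycles_linearMap (I ^ n) P g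
  let c : annCocycles (I ^ n) P g →ₗ[R] localCoh I g M :=
    cocycleClass I P g ∘ₗ Submodule.inclusion fun z hz => ⟨⟨n, hz.2⟩, hz.1⟩
  have hec : LinearMap.ker e ≤ LinearMap.ker c := by
    intro z hz
    obtain ⟨y, hy, hyz⟩ := he z hz
    exact (cocycleClass_eq_zero_iff I P g _).2 ⟨g - 1, y, ⟨n, hy⟩, hyz⟩
  have : IsNoetherian R (annCocycles (I ^ n) P g ⧸ LinearMap.ker e) :=
    isNoetherian_of_linearEquiv e.quotKerEquivRange.symm
  refine ⟨LinearMap.range c, ?_, fun h hh => ?_⟩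
  · rw [← Submodule.range_liftQ _ c hec, LinearMap.range_eq_map]
    exact Submodule.FG.map _ (IsNoetherian.noetherian _)
  · obtain ⟨z, hz, rfl⟩ := exists_annCocycles_class_eq I P g hlift n h hh
    exact ⟨⟨z.1, hz⟩, rfl⟩

omit [IsNoetherianRing R] in
theorem exists_pow_smul_localCoh_eq_zero {I : Ideal R} {i : ℕ} {M : Type u} [AddCommGroup M]
    [Module R M] (h : localCoh I i M) : ∃ n : ℕ, ∀ a ∈ I ^ n, a • h = 0 := by
  obtain ⟨z, rfl⟩ := cocycleClass_surjective I (injectiveResolution (ModuleCat.of R M)) i h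
  obtain ⟨n, hn⟩ := z.2.1
  exact ⟨n, fun a ha => by rw [← map_smul, (Subtype.ext (hn a ha) : a • z = 0), map_zero]⟩

end Finiteness

/-! ### The bidual with respect to an injective module -/

section Bidual

variable {R : Type u} [CommRing R] {E : Type u} [AddCommGroup E] [Module R E]

theorem exists_comp_eq_of_ker_le (hE : Module.Injective R E) {X Y : Type u} [AddCommGroup X]
    [Module R X] [AddCommGroup Y] [Module R Y] (q : X →ₗ[R] Y) (f : X →ₗ[R] E)
    (h : LinearMap.ker q ≤ LinearMap.ker f) : ∃ F : Y →ₗ[R] E, ∀ x, F (q x) = f x := by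
  obtain ⟨F, hF⟩ := hE.out ((LinearMap.ker q).liftQ q le_rfl)
    (LinearMap.ker_eq_bot.1 (Submodule.ker_liftQ_eq_bot _ _ _ le_rfl))
    ((LinearMap.ker q).liftQ f h)
  exact ⟨F, fun x => hF (Submodule.Quotient.mk x)⟩

theorem exists_comp_eq_of_injective (hE : Module.Injective R E) {X Y : Type u} [AddCommGroup X]
    [Module R X] [AddCommGroup Y] [Module R Y] (q : X →ₗ[R] Y) (hq : Function.Injective q)
    (f : X →ₗ[R] E) : ∃ F : Y →ₗ[R] E, F ∘ₗ q = f := by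
  obtain ⟨F, hF⟩ := hE.out q hq f
  exact ⟨F, LinearMap.ext hF⟩

variable (A : Type u) [CommRing A] [Algebra R A] [Module A E] [IsScalarTower R A E] (E)

variable (R) in
/-- The map `A ⊗ N → Hom(Hom(N, E), E)`, `a ⊗ x ↦ (f ↦ a f(x))`. -/
noncomputable def evalTensor (N : Type u) [AddCommGroup N] [Module R N] :
    A ⊗[R] N →ₗ[A] ((N →ₗ[R] E) →ₗ[R] E) :=
  LinearMap.liftBaseChange A LinearMap.applyₗ

theorem evalTensor_tmul (N : Type u) [AddCommGroup N] [Module R N] (a : A) (x : N)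
    (f : N →ₗ[R] E) : evalTensor R E A N (a ⊗ₜ x) f = a • f x := by
  simp [evalTensor]

theorem evalTensor_lTensor {N N' : Type u} [AddCommGroup N] [Module R N] [AddCommGroup N']
    [Module R N'] (h : N →ₗ[R] N') (t : A ⊗[R] N) (f : N' →ₗ[R] E) :
    evalTensor R E A N' (h.lTensor A t) f = evalTensor R E A N t (f ∘ₗ h) := by
  induction t using TensorProduct.induction_on with
  | zero => simp
  | tmul a x => simp [evalTensor_tmul]
  | add t u ht hu => simp [ht, hu]

theorem evalTensor_bijective_of_subsingleton (N : Type u) [AddCommGroup N] [Module R N]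
    [Subsingleton N] : Function.Bijective (evalTensor R E A N) := by
  have h₁ : Subsingleton (A ⊗[R] N) := inferInstance
  have h₂ : Subsingleton (N →ₗ[R] E) := inferInstance
  have h₃ : Subsingleton ((N →ₗ[R] E) →ₗ[R] E) := inferInstance
  exact ⟨fun _ _ _ => Subsingleton.elim _ _, fun y => ⟨0, Subsingleton.elim _ _⟩⟩

variable {E}

/-- For fixed injective `E`, the modules `N` with `A ⊗ N ≅ Hom(Hom(N, E), E)` are closed under
extensions: both sides are right exact, and the right side is exact, so this is a diagram chase. -/
theorem evalTensor_bijective_of_exact (hE : Module.Injective R E) {N' N N'' : Type u}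
    [AddCommGroup N'] [Module R N'] [AddCommGroup N] [Module R N] [AddCommGroup N''] [Module R N'']
    (i : N' →ₗ[R] N) (p : N →ₗ[R] N'') (hi : Function.Injective i) (hp : Function.Surjective p)
    (hip : Function.Exact i p) (h' : Function.Bijective (evalTensor R E A N'))
    (h'' : Function.Bijective (evalTensor R E A N'')) :
    Function.Bijective (evalTensor R E A N) := by
  constructor
  · rw [injective_iff_map_eq_zero]
    intro t ht
    have h₁ : p.lTensor A t = 0 := h''.1 (by
      rw [map_zero]
      refine LinearMap.ext fun f => ?_
      rw [evalTensor_lTensor, ht]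
      rfl)
    obtain ⟨u, rfl⟩ := (lTensor_exact A hip hp t).1 h₁
    have h₂ : u = 0 := h'.1 (by
      rw [map_zero]
      refine LinearMap.ext fun f => ?_
      obtain ⟨F, rfl⟩ := exists_comp_eq_of_injective hE i hi f
      rw [← evalTensor_lTensor, ht]
      rfl)
    rw [h₂, map_zero]
  · intro ξ
    obtain ⟨v, hv⟩ := h''.2 (ξ ∘ₗ LinearMap.lcomp R E p)
    obtain ⟨t, rfl⟩ := LinearMap.lTensor_surjective A hp v
    obtain ⟨ζ, hζ⟩ := exists_comp_eq_of_ker_le hE (LinearMap.lcomp R E i)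
      (ξ - evalTensor R E A N t) (by
        intro f hf
        obtain ⟨f'', rfl⟩ : ∃ f'' : N'' →ₗ[R] E, f'' ∘ₗ p = f := by
          obtain ⟨F, hF⟩ := exists_comp_eq_of_ker_le hE p f (by
            intro x hx
            obtain ⟨y, rfl⟩ := (hip x).1 hx
            exact LinearMap.congr_fun hf y)
          exact ⟨F, LinearMap.ext hF⟩
        rw [LinearMap.mem_ker, LinearMap.sub_apply, ← evalTensor_lTensor, hv]
        exact sub_self _)
    obtain ⟨u, rfl⟩ := h'.2 ζ
    refine ⟨t + i.lTensor A u, LinearMap.ext fun f => ?_⟩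
    rw [map_add, LinearMap.add_apply, evalTensor_lTensor]
    have := hζ f
    rw [LinearMap.lcomp_apply', LinearMap.sub_apply] at this
    rw [this, add_sub_cancel]

theorem evalTensor_bijective_of_equiv (hE : Module.Injective R E) {N N' : Type u}
    [AddCommGroup N] [Module R N] [AddCommGroup N'] [Module R N'] (e : N ≃ₗ[R] N')
    (h : Function.Bijective (evalTensor R E A N)) : Function.Bijective (evalTensor R E A N') :=
  evalTensor_bijective_of_exact A hE e.toLinearMap (0 : N' →ₗ[R] PUnit.{u + 1}) e.injective
    (Function.surjective_to_subsingleton _)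
    ((LinearMap.exact_zero_iff_surjective _ _).2 e.surjective) h
    (evalTensor_bijective_of_subsingleton E A _)

theorem evalTensor_pi_bijective (hE : Module.Injective R E)
    (h : Function.Bijective (evalTensor R E A R)) (n : ℕ) :
    Function.Bijective (evalTensor R E A (Fin n → R)) := by
  refine Module.pi_induction' (motive := fun N _ _ => Function.Bijective (evalTensor R E A N))
    (motive' := fun N _ _ => Function.Bijective (evalTensor R E A N)) R ?_ ?_ ?_ ?_
    (fun _ : Fin n => R) (fun _ => h)
  · exact fun e => evalTensor_bijective_of_equiv A hE e
  · exact fun e => evalTensor_bijective_of_equiv A hE e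
  · exact evalTensor_bijective_of_subsingleton E A _
  · intro N N' _ _ _ _ hN hN'
    exact evalTensor_bijective_of_exact A hE (LinearMap.inl R N N') (LinearMap.snd R N N')
      LinearMap.inl_injective LinearMap.snd_surjective Function.Exact.inl_snd hN hN'

theorem evalTensor_surjective_of_finite (hE : Module.Injective R E)
    (h : Function.Bijective (evalTensor R E A R)) (N : Type u) [AddCommGroup N] [Module R N]
    [Module.Finite R N] : Function.Surjective (evalTensor R E A N) := by
  intro ξ
  obtain ⟨n, p, hp⟩ := Module.Finite.exists_fin' R N
  obtain ⟨ξ', hξ'⟩ := exists_comp_eq_of_injective hE (LinearMap.lcomp R E p)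
    (fun f g hfg => LinearMap.ext fun x => by
      obtain ⟨x, rfl⟩ := hp x
      exact LinearMap.congr_fun hfg x) ξ
  obtain ⟨t, rfl⟩ := (evalTensor_pi_bijective A hE h n).2 ξ'
  refine ⟨p.lTensor A t, LinearMap.ext fun f => ?_⟩
  rw [evalTensor_lTensor, ← hξ']
  rfl

theorem evalTensor_injective_of_finite [IsNoetherianRing R] (hE : Module.Injective R E)
    (h : Function.Bijective (evalTensor R E A R)) (N : Type u) [AddCommGroup N] [Module R N]
    [Module.Finite R N] : Function.Injective (evalTensor R E A N) := by
  rw [injective_iff_map_eq_zero]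
  intro t ht
  obtain ⟨n, p, hp⟩ := Module.Finite.exists_fin' R N
  obtain ⟨t, rfl⟩ := LinearMap.lTensor_surjective A hp t
  let i := (LinearMap.ker p).subtype
  have hip : Function.Exact i p := LinearMap.exact_subtype_ker_map p
  obtain ⟨ζ, hζ⟩ := exists_comp_eq_of_ker_le hE (LinearMap.lcomp R E i)
    (evalTensor R E A _ t) (by
      intro f hf
      obtain ⟨F, hF⟩ := exists_comp_eq_of_ker_le hE p f (by
        intro x hx
        exact LinearMap.congr_fun hf ⟨x, hx⟩)
      obtain rfl : F ∘ₗ p = f := LinearMap.ext hF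
      rw [LinearMap.mem_ker, ← evalTensor_lTensor, ht]
      rfl)
  obtain ⟨u, rfl⟩ := evalTensor_surjective_of_finite A hE h _ ζ
  have : i.lTensor A u = t := (evalTensor_pi_bijective A hE h n).1 (LinearMap.ext fun f => by
    rw [evalTensor_lTensor]
    exact hζ f)
  exact (lTensor_exact A hip hp t).2 ⟨u, this⟩

/-- `A ⊗ X → Hom(Hom(X, E), E)` is injective for every module `X` if `A ≅ Hom(E, E)`. No flatness of
`A` is needed: an element of the kernel comes from `A ⊗ N` with `N ≤ X` finite, and linear forms
on `N` extend to `X`. -/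
theorem evalTensor_injective [IsNoetherianRing R] (hE : Module.Injective R E)
    (h : Function.Bijective (evalTensor R E A R)) (X : Type u) [AddCommGroup X] [Module R X] :
    Function.Injective (evalTensor R E A X) := by
  rw [injective_iff_map_eq_zero]
  intro t ht
  obtain ⟨N, hN, hN'⟩ := TensorProduct.exists_finite_submodule_right_of_setFinite {t}
    (Set.finite_singleton t)
  obtain ⟨u, rfl⟩ := hN' rfl
  have : u = 0 := evalTensor_injective_of_finite A hE h N (by
    rw [map_zero]
    refine LinearMap.ext fun f => ?_
    obtain ⟨F, rfl⟩ := exists_comp_eq_of_injective hE N.subtype N.subtype_injective f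
    rw [← evalTensor_lTensor, ht]
    rfl)
  rw [this, map_zero]

/-- An element of the bidual of `X` that is killed by an ideal `J` comes from `A ⊗ X`, if the
submodule `0 :_X J` is finite: it vanishes on every `f` that is zero on `0 :_X J`, because such an
`f` is a combination of linear forms with coefficients in `J`. -/
theorem exists_evalTensor_eq_of_smul_eq_zero [IsNoetherianRing R] (hE : Module.Injective R E)
    (h : Function.Bijective (evalTensor R E A R)) (X : Type u) [AddCommGroup X] [Module R X]
    (J : Ideal R) (N : Submodule R X) (hN : N.FG) (hJN : ∀ x, (∀ a ∈ J, a • x = 0) → x ∈ N)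
    (ξ : (X →ₗ[R] E) →ₗ[R] E) (hξ : ∀ a ∈ J, a • ξ = 0) : ∃ t, evalTensor R E A X t = ξ := by
  have hker : ∀ f : X →ₗ[R] E, (∀ x ∈ N, f x = 0) → ξ f = 0 := by
    intro f hf
    obtain ⟨k, a, ha⟩ := Submodule.fg_iff_exists_fin_generating_family.1
      (IsNoetherian.noetherian J)
    have ha' (b : Fin k) : a b ∈ J := ha ▸ Submodule.subset_span ⟨b, rfl⟩
    let q : X →ₗ[R] (Fin k → X) := LinearMap.pi fun b => a b • LinearMap.id
    obtain ⟨F, hF⟩ := exists_comp_eq_of_ker_le hE q f (by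
      intro x hx
      refine hf x (hJN x fun r hr => ?_)
      rw [← ha] at hr
      induction hr using Submodule.span_induction with
      | mem r hr =>
        obtain ⟨b, rfl⟩ := hr
        exact congrFun hx b
      | zero => rw [zero_smul]
      | add r s _ _ hr hs => rw [add_smul, hr, hs, add_zero]
      | smul t r _ hr => rw [smul_assoc, hr, smul_zero])
    have hf' : f = ∑ b, a b • (F ∘ₗ LinearMap.single R (fun _ => X) b) := by
      refine LinearMap.ext fun x => ?_
      rw [← hF, LinearMap.sum_apply]
      conv_lhs => rw [← LinearMap.sum_single_apply (φ := fun _ => X) (q x), map_sum]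
      refine Finset.sum_congr rfl fun b _ => ?_
      change F (Pi.single b (a b • x)) = a b • F (Pi.single b x)
      rw [← map_smul, Pi.single_smul]
    rw [hf', map_sum]
    refine Finset.sum_eq_zero fun b _ => ?_
    rw [map_smul]
    exact LinearMap.congr_fun (hξ (a b) (ha' b)) _
  obtain ⟨ζ, hζ⟩ := exists_comp_eq_of_ker_le hE (LinearMap.lcomp R E N.subtype) ξ
    fun f hf => hker f fun x hx => LinearMap.congr_fun hf ⟨x, hx⟩
  have : Module.Finite R N := Module.Finite.iff_fg.2 hN
  obtain ⟨u, rfl⟩ := evalTensor_surjective_of_finite A hE h N ζ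
  refine ⟨N.subtype.lTensor A u, LinearMap.ext fun f => ?_⟩
  rw [evalTensor_lTensor]
  exact hζ f

end Bidual

/-! ### Matlis duality over the residue hull -/

section ResidueHull

variable {R : Type u} [CommRing R] [IsLocalRing R]

theorem injective_residueHull : Module.Injective R (ResidueHull R) :=
  (exists_isInjectiveHull_residueHull R).choose_spec.injective_module

/-- The socle of `E_R(𝕜)` is a copy of `𝕜`. -/
theorem exists_socle_generator : ∃ s : ResidueHull R, (∀ r : R, r • s = 0 ↔ r ∈ maximalIdeal R) ∧
    ∀ x : ResidueHull R, (∀ a ∈ maximalIdeal R, a • x = 0) → ∃ r : R, x = r • s := by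
  obtain ⟨j, hj⟩ := exists_isInjectiveHull_residueHull R
  have hj1 : ∀ r : R, r • j 1 = j (residue R r) := fun r => by
    rw [← map_smul, Algebra.smul_def, mul_one]
    rfl
  refine ⟨j 1, fun r => ?_, fun x hx => ?_⟩
  · rw [hj1, map_eq_zero_iff j hj.injective, residue_eq_zero_iff]
  · by_cases hx0 : x = 0
    · exact ⟨0, by rw [hx0, zero_smul]⟩
    have h0 : Submodule.span R {x} ⊓ LinearMap.range j ≠ ⊥ := fun h =>
      hx0 (by simpa using hj.essential _ h)
    obtain ⟨z, ⟨hz, c, hc⟩, hz0⟩ := Submodule.exists_mem_ne_zero_of_ne_bot h0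
    obtain ⟨r, rfl⟩ := Submodule.mem_span_singleton.1 hz
    have hr : IsUnit r := by
      by_contra hr
      exact hz0 (hx r ((mem_maximalIdeal r).2 hr))
    obtain ⟨v, rfl⟩ := hr
    obtain ⟨c, rfl⟩ := residue_surjective c
    refine ⟨↑v⁻¹ * c, ?_⟩
    rw [mul_smul, hj1, hc, smul_smul, Units.inv_mul, one_smul]

/-- `E_R(𝕜)` is a cogenerator. -/
theorem exists_residueHull_ne_zero {X : Type u} [AddCommGroup X] [Module R X] {x : X}
    (hx : x ≠ 0) : ∃ f : X →ₗ[R] ResidueHull R, f x ≠ 0 := by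
  obtain ⟨s, hs, -⟩ := exists_socle_generator (R := R)
  obtain ⟨F, hF⟩ := exists_comp_eq_of_ker_le injective_residueHull
    (LinearMap.toSpanSingleton R X x) (LinearMap.toSpanSingleton R _ s) (by
      intro r hr
      refine (hs r).2 ?_
      by_contra hr'
      have hu : IsUnit r := by simpa using hr'
      exact hx ((hu.smul_eq_zero).1 hr))
  refine ⟨F, fun h => ?_⟩
  have h1 := hF 1
  rw [LinearMap.toSpanSingleton_apply_one, LinearMap.toSpanSingleton_apply_one, h] at h1
  have := (hs 1).1 (by rw [one_smul, ← h1])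
  exact (maximalIdeal.isMaximal R).ne_top ((Ideal.eq_top_iff_one _).2 this)

/-- Matlis biduality for the residue field. -/
theorem evalTensor_bijective_of_equiv_residueField (N : Type u) [AddCommGroup N] [Module R N]
    (e : N ≃ₗ[R] R ⧸ maximalIdeal R) : Function.Bijective (evalTensor R (ResidueHull R) R N) := by
  constructor
  · rw [injective_iff_map_eq_zero]
    intro t ht
    obtain ⟨x, rfl⟩ := (TensorProduct.lid R N).symm.surjective t
    by_contra hx
    obtain ⟨f, hf⟩ := exists_residueHull_ne_zero (R := R) (x := x) fun h => hx (by rw [h, map_zero])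
    refine hf ?_
    have := LinearMap.congr_fun ht f
    rwa [TensorProduct.lid_symm_apply, evalTensor_tmul, one_smul] at this
  · intro ξ
    obtain ⟨s, hs, hs'⟩ := exists_socle_generator (R := R)
    let x₀ := e.symm (Ideal.Quotient.mk _ 1)
    have hx₀ : ∀ x : N, ∃ r : R, x = r • x₀ := by
      intro x
      obtain ⟨r, hr⟩ := Ideal.Quotient.mk_surjective (e x)
      refine ⟨r, e.injective ?_⟩
      rw [map_smul, LinearEquiv.apply_symm_apply, ← hr]
      exact congrArg (Ideal.Quotient.mk _) (mul_one r).symm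
    have hm : ∀ a ∈ maximalIdeal R, a • x₀ = 0 := by
      intro a ha
      refine e.injective ?_
      rw [map_smul, LinearEquiv.apply_symm_apply, map_zero]
      refine (congrArg (Ideal.Quotient.mk _) (mul_one a)).trans ?_
      exact Ideal.Quotient.eq_zero_iff_mem.2 ha
    let f₀ : N →ₗ[R] ResidueHull R := ofAnn (maximalIdeal R) s (fun a ha => (hs a).2 ha) ∘ₗ e
    have hf₀ : f₀ x₀ = s := by
      change ofAnn (maximalIdeal R) s (fun a ha => (hs a).2 ha) (e x₀) = s
      rw [LinearEquiv.apply_symm_apply]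
      exact one_smul R s
    have hf₀m : ∀ a ∈ maximalIdeal R, a • f₀ = 0 := by
      intro a ha
      refine LinearMap.ext fun x => ?_
      obtain ⟨r, rfl⟩ := hx₀ x
      rw [LinearMap.smul_apply, ← map_smul, smul_comm, hm a ha, smul_zero, map_zero]
      rfl
    obtain ⟨r, hr⟩ := hs' (ξ f₀) fun a ha => by rw [← map_smul, hf₀m a ha, map_zero]
    refine ⟨1 ⊗ₜ (r • x₀), LinearMap.ext fun f => ?_⟩
    obtain ⟨c, hc⟩ := hs' (f x₀) fun a ha => by rw [← map_smul, hm a ha, map_zero]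
    have hf : f = c • f₀ := LinearMap.ext fun x => by
      obtain ⟨b, rfl⟩ := hx₀ x
      rw [map_smul, hc, LinearMap.smul_apply, map_smul, hf₀, smul_comm]
    rw [evalTensor_tmul, one_smul, map_smul, hc, hf, map_smul, hr, smul_comm]

/-- `r ∈ 𝔪ⁿ` if `r` kills all elements of `E_R(𝕜)` killed by `𝔪ⁿ`. -/
theorem mem_pow_of_smul_residueHull (n : ℕ) (r : R) (h : ∀ x : ResidueHull R,
    (∀ a ∈ maximalIdeal R ^ n, a • x = 0) → r • x = 0) : r ∈ maximalIdeal R ^ n := by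
  rw [← Ideal.Quotient.eq_zero_iff_mem]
  by_contra hr
  obtain ⟨f, hf⟩ := exists_residueHull_ne_zero (R := R) hr
  have hmk : ∀ a : R, f (Ideal.Quotient.mk _ a) = a • f (Ideal.Quotient.mk _ 1) := fun a => by
    rw [← map_smul]
    exact congrArg (fun b => f (Ideal.Quotient.mk _ b)) (mul_one a).symm
  refine hf ((hmk r).trans (h _ fun a ha => ?_))
  rw [← hmk, Ideal.Quotient.eq_zero_iff_mem.2 ha, map_zero]

variable [IsNoetherianRing R]

/-- Matlis biduality for finite modules killed by a power of `𝔪`. -/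
theorem evalTensor_bijective_of_pow_smul_eq_zero (N : Type u) [AddCommGroup N] [Module R N]
    [hfin : Module.Finite R N] (n : ℕ) (hN : ∀ a ∈ maximalIdeal R ^ n, ∀ x : N, a • x = 0) :
    Function.Bijective (evalTensor R (ResidueHull R) R N) := by
  induction hfin using IsNoetherianRing.induction_on_isQuotientEquivQuotientPrime R with
  | subsingleton N => exact evalTensor_bijective_of_subsingleton _ _ _
  | quotient N p e =>
    have hp : maximalIdeal R ≤ p.1 := by
      refine p.2.le_of_pow_le (n := n) fun a ha => ?_
      have := hN a ha (e.symm (Ideal.Quotient.mk _ 1))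
      rw [← map_smul, LinearEquiv.map_eq_zero_iff] at this
      refine Ideal.Quotient.eq_zero_iff_mem.1 (Eq.trans ?_ this)
      exact congrArg (Ideal.Quotient.mk _) (mul_one a).symm
    have hp' : p.1 = maximalIdeal R := ((maximalIdeal.isMaximal R).eq_of_le p.2.ne_top hp).symm
    exact evalTensor_bijective_of_equiv_residueField N
      (e.trans (Submodule.quotEquivOfEq _ _ hp'))
  | exact N₁ N₂ N₃ f g hf hg hfg h₁ h₃ =>
    refine evalTensor_bijective_of_exact R injective_residueHull f g hf hg hfg
      (h₁ fun a ha x => hf ?_) (h₃ fun a ha x => ?_)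
    · rw [map_smul, hN a ha, map_zero]
    · obtain ⟨x, rfl⟩ := hg x
      rw [← map_smul, hN a ha, map_zero]

/-- An endomorphism of `E_R(𝕜)` is multiplication by an element of `R` on `0 :_E 𝔪ⁿ`. -/
theorem exists_forall_eq_smul (φ : ResidueHull R →ₗ[R] ResidueHull R) (n : ℕ) :
    ∃ r : R, ∀ x : ResidueHull R, (∀ a ∈ maximalIdeal R ^ n, a • x = 0) → φ x = r • x := by
  let N := R ⧸ maximalIdeal R ^ n
  have hN : Function.Bijective (evalTensor R (ResidueHull R) R N) :=
    evalTensor_bijective_of_pow_smul_eq_zero N n fun a ha x => by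
      obtain ⟨r, rfl⟩ := Ideal.Quotient.mk_surjective x
      rw [← Ideal.Quotient.mk_eq_mk, ← Submodule.Quotient.mk_smul,
        Submodule.Quotient.mk_eq_zero]
      exact Ideal.mul_mem_right r _ ha
  obtain ⟨t, ht⟩ := hN.2 (φ ∘ₗ LinearMap.applyₗ (Ideal.Quotient.mk _ 1))
  obtain ⟨y, rfl⟩ := (TensorProduct.lid R N).symm.surjective t
  obtain ⟨r, rfl⟩ := Ideal.Quotient.mk_surjective y
  refine ⟨r, fun x hx => ?_⟩
  have h := LinearMap.congr_fun ht (ofAnn _ x hx)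
  rw [TensorProduct.lid_symm_apply, evalTensor_tmul, one_smul, ofAnn_mk] at h
  rw [h]
  exact congrArg φ (one_smul R x).symm

/-- `R̂ ≅ Hom_R(E, E)`: on `0 :_E 𝔪ⁿ` an endomorphism is multiplication by some `r n ∈ R`, unique
modulo `𝔪ⁿ`, and the `r n` form a Cauchy sequence. -/
theorem toModuleEnd_residueHull_bijective :
    Function.Bijective (Module.toModuleEnd R (S := ComplRing R) (ResidueHull R)) := by
  constructor
  · rw [injective_iff_map_eq_zero]
    intro a ha
    refine AdicCompletion.ext_evalₐ fun n => ?_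
    obtain ⟨r, hr⟩ := exists_compl_eq n a
    rw [hr, map_zero, Ideal.Quotient.eq_zero_iff_mem]
    refine mem_pow_of_smul_residueHull n r fun x hx => ?_
    rw [← compl_smul_eq hx hr]
    exact LinearMap.congr_fun ha x
  · intro φ
    choose r hr using exists_forall_eq_smul φ
    let a : AdicCompletion.AdicCauchySequence (maximalIdeal R) R :=
      AdicCompletion.AdicCauchySequence.mk _ _ r fun n => by
        rw [SModEq.sub_mem, smul_eq_mul, Ideal.mul_top]
        refine mem_pow_of_smul_residueHull n _ fun x hx => ?_
        rw [sub_smul, ← hr n x hx, ← hr (n + 1) x fun b hb =>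
          hx b (Ideal.pow_le_pow_right n.le_succ hb), sub_self]
    refine ⟨AdicCompletion.mk _ _ a, LinearMap.ext fun x => ?_⟩
    obtain ⟨n, hn⟩ := exists_pow_smul_eq_zero x
    rw [hr n x hn]
    exact compl_smul_eq hn (AdicCompletion.evalₐ_mk _ n a)

/-- `R̂ ≅ Hom_R(E, E)`, stated for the biduality map of the free module `R`. -/
theorem evalTensor_compl_bijective :
    Function.Bijective (evalTensor R (ResidueHull R) (ComplRing R) R) := by
  have h : ∀ (t : ComplRing R ⊗[R] R) (f : R →ₗ[R] ResidueHull R),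
      evalTensor R (ResidueHull R) (ComplRing R) R t f =
        TensorProduct.rid R (ComplRing R) t • f 1 := by
    intro t f
    obtain ⟨a, rfl⟩ := (TensorProduct.rid R (ComplRing R)).symm.surjective t
    rw [LinearEquiv.apply_symm_apply, TensorProduct.rid_symm_apply, evalTensor_tmul]
  constructor
  · intro t t' htt'
    refine (TensorProduct.rid R (ComplRing R)).injective
      (toModuleEnd_residueHull_bijective.1 (LinearMap.ext fun x => ?_))
    have := LinearMap.congr_fun htt' (LinearMap.toSpanSingleton R _ x)
    rwa [h, h, LinearMap.toSpanSingleton_apply_one] at this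
  · intro ξ
    obtain ⟨a, ha⟩ := toModuleEnd_residueHull_bijective.2
      (ξ ∘ₗ (LinearMap.ringLmapEquivSelf R R (ResidueHull R)).symm.toLinearMap)
    refine ⟨(TensorProduct.rid R (ComplRing R)).symm a, LinearMap.ext fun f => ?_⟩
    rw [h, LinearEquiv.apply_symm_apply]
    refine (LinearMap.congr_fun ha (f 1)).trans (congrArg ξ ?_)
    exact (LinearMap.ringLmapEquivSelf R R (ResidueHull R)).symm_apply_apply f

end ResidueHull

/-! ### Transposition of endomorphisms -/

section Transposition

variable {R A : Type u} [CommRing R] [CommRing A] [Algebra R A] {E : Type u} [AddCommGroup E]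
  [Module R E] [Module A E] [IsScalarTower R A E] {X Y : Type u} [AddCommGroup X] [Module R X]
  [AddCommGroup Y] [Module A Y]

variable (E) in
/-- If `Y` is the base change of `X` along `R → A`, then `R`-linear maps `X → E` extend uniquely to
`A`-linear maps `Y → E`. -/
noncomputable def extendEquiv (l : A ⊗[R] X ≃ₗ[A] Y) : (X →ₗ[R] E) ≃ₗ[A] (Y →ₗ[A] E) :=
  (LinearMap.liftBaseChangeEquiv A).trans (l.arrowCongr (LinearEquiv.refl A E))

theorem extendEquiv_apply (l : A ⊗[R] X ≃ₗ[A] Y) (f : X →ₗ[R] E) (t : A ⊗[R] X) :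
    extendEquiv E l f (l t) = evalTensor R E A X t f := by
  have h : extendEquiv E l f (l t) = f.liftBaseChange A t := by
    change f.liftBaseChange A (l.symm (l t)) = _
    rw [l.symm_apply_apply]
  rw [h]
  clear h
  induction t using TensorProduct.induction_on with
  | zero => simp
  | tmul a x => simp [evalTensor_tmul]
  | add t u ht hu => simp [ht, hu]

theorem extendEquiv_tmul (l : A ⊗[R] X ≃ₗ[A] Y) (f : X →ₗ[R] E) (x : X) :
    extendEquiv E l f (l (1 ⊗ₜ x)) = f x := by
  rw [extendEquiv_apply, evalTensor_tmul, one_smul]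

theorem eq_extendEquiv (l : A ⊗[R] X ≃ₗ[A] Y) (f : X →ₗ[R] E) (F : Y →ₗ[A] E)
    (h : ∀ x, F (l (1 ⊗ₜ x)) = f x) : F = extendEquiv E l f := by
  obtain ⟨f', rfl⟩ := (extendEquiv E l).surjective F
  refine congrArg _ (LinearMap.ext fun x => ?_)
  rw [← h, extendEquiv_tmul]

variable (E) in
/-- Transposition: an endomorphism `φ` of `Y = A ⊗ X` acts on `Hom_R(X, E) = Hom_A(Y, E)` by
precomposition. -/
noncomputable def transpose (l : A ⊗[R] X ≃ₗ[A] Y) :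
    Module.End A Y →ₗ[A] Module.End R (X →ₗ[R] E) where
  toFun φ := ((extendEquiv E l).symm.toLinearMap ∘ₗ LinearMap.lcomp A E φ ∘ₗ
    (extendEquiv E l).toLinearMap).restrictScalars R
  map_add' φ ψ := by
    refine LinearMap.ext fun f => (extendEquiv E l).injective ?_
    refine LinearMap.ext fun y => ?_
    simp
  map_smul' a φ := by
    refine LinearMap.ext fun f => (extendEquiv E l).injective ?_
    refine LinearMap.ext fun y => ?_
    simp

theorem extendEquiv_transpose (l : A ⊗[R] X ≃ₗ[A] Y) (φ : Module.End A Y) (f : X →ₗ[R] E) (y : Y) :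
    extendEquiv E l (transpose E l φ f) y = extendEquiv E l f (φ y) := by
  change extendEquiv E l ((extendEquiv E l).symm _) y = _
  rw [LinearEquiv.apply_symm_apply]
  rfl

theorem transpose_apply (l : A ⊗[R] X ≃ₗ[A] Y) (φ : Module.End A Y) (f : X →ₗ[R] E) (x : X) :
    transpose E l φ f x = extendEquiv E l f (φ (l (1 ⊗ₜ x))) := by
  rw [← extendEquiv_transpose, extendEquiv_tmul]

theorem transpose_toModuleEnd (l : A ⊗[R] X ≃ₗ[A] Y) (a : A) :
    transpose E l (Module.toModuleEnd A (S := A) Y a) =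
      Module.toModuleEnd R (S := A) (X →ₗ[R] E) a := by
  refine LinearMap.ext fun f => LinearMap.ext fun x => ?_
  rw [transpose_apply]
  change extendEquiv E l f (a • l (1 ⊗ₜ x)) = a • f x
  rw [map_smul, extendEquiv_tmul]

/-- Linear forms with values in `E` separate the points of `Y` if `A ⊗ X` embeds in the bidual. -/
theorem extendEquiv_ext (l : A ⊗[R] X ≃ₗ[A] Y) (h : Function.Injective (evalTensor R E A X))
    {y z : Y} (hyz : ∀ f : X →ₗ[R] E, extendEquiv E l f y = extendEquiv E l f z) : y = z := by
  obtain ⟨t, rfl⟩ := l.surjective y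
  obtain ⟨u, rfl⟩ := l.surjective z
  refine congrArg l (h (LinearMap.ext fun f => ?_))
  rw [← extendEquiv_apply l, ← extendEquiv_apply l, hyz]

theorem transpose_injective (l : A ⊗[R] X ≃ₗ[A] Y)
    (h : Function.Injective (evalTensor R E A X)) : Function.Injective (transpose E l) := by
  intro φ ψ hφψ
  refine LinearMap.ext fun y => extendEquiv_ext (E := E) l h fun f => ?_
  rw [← extendEquiv_transpose, ← extendEquiv_transpose, hφψ]

/-- Every endomorphism `ψ` of `Hom_R(X, E)` is a transpose if each of the functionals
`f ↦ ψ(f)(x)` is evaluation at an element of `A ⊗ X`. -/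
theorem transpose_surjective (l : A ⊗[R] X ≃ₗ[A] Y)
    (h : Function.Injective (evalTensor R E A X))
    (hs : ∀ (ψ : Module.End R (X →ₗ[R] E)) (x : X),
      ∃ t, evalTensor R E A X t = LinearMap.applyₗ x ∘ₗ ψ) :
    Function.Surjective (transpose E l) := by
  intro ψ
  choose t ht using hs ψ
  let τ : X →ₗ[R] A ⊗[R] X :=
    { toFun := t
      map_add' := fun x y => h (by
        rw [map_add, ht, ht, ht, map_add, LinearMap.add_comp])
      map_smul' := fun r x => h (by
        rw [LinearMap.map_smul_of_tower, ht, ht, map_smul, LinearMap.smul_comp]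
        rfl) }
  refine ⟨l.toLinearMap ∘ₗ τ.liftBaseChange A ∘ₗ l.symm.toLinearMap,
    LinearMap.ext fun f => LinearMap.ext fun x => ?_⟩
  rw [transpose_apply]
  simp only [LinearMap.comp_apply, LinearEquiv.coe_coe, LinearEquiv.symm_apply_apply,
    LinearMap.liftBaseChange_tmul, one_smul]
  rw [extendEquiv_apply]
  exact LinearMap.congr_fun (ht x) f

end Transposition

/-! ### The evaluation map -/

section Evaluation

variable {R : Type u} [CommRing R] [IsLocalRing R]

/-- The functor `Hom_R(-, E_R(𝕜))` reflects isomorphisms. -/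
theorem lcomp_residueHull_bijective_iff {X Y : Type u} [AddCommGroup X] [Module R X]
    [AddCommGroup Y] [Module R Y] (h : X →ₗ[R] Y) :
    Function.Bijective (LinearMap.lcomp R (ResidueHull R) h) ↔ Function.Bijective h := by
  refine ⟨fun H => ⟨?_, ?_⟩, fun H => ⟨?_, ?_⟩⟩
  · rw [injective_iff_map_eq_zero]
    intro x hx
    by_contra hx0
    obtain ⟨f, hf⟩ := exists_residueHull_ne_zero (R := R) hx0
    obtain ⟨F, rfl⟩ := H.2 f
    exact hf (by rw [LinearMap.lcomp_apply, hx, map_zero])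
  · intro y
    by_contra hy
    have hy0 : (LinearMap.range h).mkQ y ≠ 0 := by simpa using hy
    obtain ⟨f, hf⟩ := exists_residueHull_ne_zero (R := R) hy0
    have : f ∘ₗ (LinearMap.range h).mkQ = 0 := H.1 (by
      refine LinearMap.ext fun x => ?_
      change f ((LinearMap.range h).mkQ (h x)) = 0
      rw [Submodule.mkQ_apply,
        (Submodule.Quotient.mk_eq_zero _).2 (LinearMap.mem_range_self h x), map_zero])
    exact hf (LinearMap.congr_fun this y)
  · intro f g hfg
    refine LinearMap.ext fun y => ?_
    obtain ⟨x, rfl⟩ := H.2 y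
    exact LinearMap.congr_fun hfg x
  · exact exists_comp_eq_of_injective injective_residueHull h H.1

/-- Under `Hom(X ⊗ D(X), E) ≅ Hom(D(X), D(X))`, the action of `R̂ ≅ Hom(E, E)` on `D(X)` is
precomposition with the evaluation map. -/
theorem evalMap_bijective_iff [IsNoetherianRing R] (X : Type u) [AddCommGroup X] [Module R X] :
    Function.Bijective (evalMap R X) ↔
      Function.Bijective (Module.toModuleEnd R (S := ComplRing R) (MatlisDual R X)) := by
  let β : (X ⊗[R] MatlisDual R X →ₗ[R] ResidueHull R) → Module.End R (MatlisDual R X) :=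
    fun w => (TensorProduct.curry w).flip
  have hβ : Function.Bijective β := by
    refine Function.bijective_iff_has_inverse.2
      ⟨fun w => TensorProduct.lift w.flip, fun w => ?_, fun w => ?_⟩
    · exact TensorProduct.ext' fun x f => rfl
    · exact LinearMap.ext fun f => LinearMap.ext fun x => rfl
  have h : (Module.toModuleEnd R (S := ComplRing R) (MatlisDual R X) : _ → _) =
      β ∘ LinearMap.lcomp R (ResidueHull R) (evalMap R X) ∘
        Module.toModuleEnd R (S := ComplRing R) (ResidueHull R) := by
    funext a
    exact LinearMap.ext fun f => LinearMap.ext fun x => rfl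
  rw [h, hβ.of_comp_iff', Function.Bijective.of_comp_iff _ toModuleEnd_residueHull_bijective,
    lcomp_residueHull_bijective_iff]

end Evaluation

/-! ### Local cohomology of the completion -/

section Completion

variable {R : Type u} [CommRing R] [IsLocalRing R] [IsNoetherianRing R]

theorem isBaseChange_adicCompletion_of (M : Type u) [AddCommGroup M] [Module R M]
    [Module.Finite R M] :
    IsBaseChange (ComplRing R) (AdicCompletion.of (maximalIdeal R) M) := by
  refine IsBaseChange.of_equiv
    (AdicCompletion.ofTensorProductEquivOfFiniteNoetherian (maximalIdeal R) M) fun x => ?_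
  change AdicCompletion.ofTensorProduct (maximalIdeal R) M (1 ⊗ₜ x) = _
  rw [AdicCompletion.ofTensorProduct_tmul, one_smul]

/-- `R̂ ⊗ H^i_I(M) ≅ H^i_{IR̂}(M̂)`. -/
noncomputable def localCohComplEquiv (I : Ideal R) (i : ℕ) (M : Type u) [AddCommGroup M]
    [Module R M] [Module.Finite R M] :
    ComplRing R ⊗[R] localCoh I i M ≃ₗ[ComplRing R]
      localCoh (complIdeal I) i (ComplModule R M) :=
  LinearEquiv.ofBijective
    (baseChangeLocalCoh I i (AdicCompletion.of (maximalIdeal R) M))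
    (baseChangeLocalCoh_bijective I i _ (isBaseChange_adicCompletion_of M))

theorem localCohComplEquiv_tmul (I : Ideal R) (i : ℕ) (M : Type u) [AddCommGroup M]
    [Module R M] [Module.Finite R M] (x : localCoh I i M) :
    localCohComplEquiv I i M (1 ⊗ₜ x) = localCohCompl I i M x :=
  (baseChangeLocalCoh_tmul I i _ 1 x).trans (one_smul _ _)

/-- In the degree of the grade, transposition is bijective: the functional `f ↦ ψ(f)(x)` on
`D(H)` is killed by a power of `I`, and `0 :_H Iⁿ` is finite. -/
theorem transpose_localCoh_bijective (I : Ideal R) (M : Type u) [AddCommGroup M]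
    [Module R M] [Module.Finite R M] (g : ℕ) (hg : (g : ℕ∞) ≤ idealGrade I M) :
    Function.Bijective (transpose (ResidueHull R) (localCohComplEquiv I g M)) := by
  have hinj := evalTensor_injective (ComplRing R) injective_residueHull evalTensor_compl_bijective
    (localCoh I g M)
  refine ⟨transpose_injective _ hinj, transpose_surjective _ hinj fun ψ x => ?_⟩
  obtain ⟨n, hn⟩ := exists_pow_smul_localCoh_eq_zero x
  obtain ⟨N, hN, hN'⟩ := fg_annihilated_localCoh I M g hg n
  refine exists_evalTensor_eq_of_smul_eq_zero (ComplRing R) injective_residueHull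
    evalTensor_compl_bijective _ (I ^ n) N hN hN' _ fun a ha => LinearMap.ext fun f => ?_
  change a • ψ f x = 0
  rw [← map_smul, hn a ha, map_zero]

end Completion

end LocCoh

theorem theorem3p1 {R : Type u} [CommRing R] [IsLocalRing R] [IsNoetherianRing R] (I : Ideal R)
    (M : Type u) [AddCommGroup M] [Module R M] [Module.Finite R M]
    (g : ℕ) (hg : LocCoh.idealGrade I M = g) :
    (∀ f : LocCoh.MatlisDual R (LocCoh.localCoh I g M),
      ∃! F : LocCoh.localCoh (LocCoh.complIdeal I) g (LocCoh.ComplModule R M)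
          →ₗ[LocCoh.ComplRing R] LocCoh.ResidueHull R,
        ∀ x, F (LocCoh.localCohCompl I g M x) = f x) ∧
    (∃ Θ : Module.End (LocCoh.ComplRing R)
          (LocCoh.localCoh (LocCoh.complIdeal I) g (LocCoh.ComplModule R M))
        ≃ₗ[LocCoh.ComplRing R] Module.End R (LocCoh.MatlisDual R (LocCoh.localCoh I g M)),
      ∀ φ (F : LocCoh.localCoh (LocCoh.complIdeal I) g (LocCoh.ComplModule R M)
          →ₗ[LocCoh.ComplRing R] LocCoh.ResidueHull R)
        (f : LocCoh.MatlisDual R (LocCoh.localCoh I g M)),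
        (∀ x, F (LocCoh.localCohCompl I g M x) = f x) →
        ∀ x, Θ φ f x = F (φ (LocCoh.localCohCompl I g M x))) ∧
    [Function.Bijective (LocCoh.evalMap R (LocCoh.localCoh I g M)),
      Function.Bijective (Module.toModuleEnd (LocCoh.ComplRing R) (S := LocCoh.ComplRing R)
        (LocCoh.localCoh (LocCoh.complIdeal I) g (LocCoh.ComplModule R M))),
      Function.Bijective (Module.toModuleEnd R (S := LocCoh.ComplRing R)
        (LocCoh.MatlisDual R (LocCoh.localCoh I g M)))].TFAE := by
  let l := LocCoh.localCohComplEquiv I g M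
  have hl (x) : l (1 ⊗ₜ[R] x) = LocCoh.localCohCompl I g M x :=
    LocCoh.localCohComplEquiv_tmul I g M x
  have hT := LocCoh.transpose_localCoh_bijective I M g hg.ge
  refine ⟨fun f => ⟨LocCoh.extendEquiv _ l f, fun x => ?_, fun F hF => ?_⟩,
    ⟨LinearEquiv.ofBijective _ hT, fun φ F f hF x => ?_⟩, ?_⟩
  · rw [← hl, LocCoh.extendEquiv_tmul]
  · exact LocCoh.eq_extendEquiv l f F fun x => by rw [hl, hF]
  · rw [LocCoh.eq_extendEquiv l f F fun x => by rw [hl, hF], ← hl]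
    exact LocCoh.transpose_apply l φ f x
  · tfae_have 1 ↔ 3 := LocCoh.evalMap_bijective_iff _
    tfae_have 2 ↔ 3 := by
      rw [← hT.of_comp_iff']
      exact iff_of_eq (congrArg Function.Bijective
        (funext fun a => LocCoh.transpose_toModuleEnd l a))
    tfae_finish
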